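/- Let $X\subset\mathbb R$ be an interval with the Euclidean metric $d$ and Borel $\sigma$-algebra, $\mu$ a Borel probability measure on $X$, $T\colon X\to X$ a measurable map preserving $\mu$, and $(r_n)_{n\ge1}$ a sequence of positive numbers. For $r>0$ put \[ F_{n,r}=\{x\in X: d(T^ix,T^jx)<r\ \text{for some } 0\le i<j<n\}, \] and let $B(x,r)=\{y\in X: d(x,y)<r\}$. Let $BV$ be the space of functions $\psi\colon X\to\mathbb R$ of bounded variation, with $\|\psi\|_{BV}=\sup|\psi|+\operatorname{Var}\psi$. We say that $(X,T,\mu)$ is \emph{exponentially mixing for $BV$ against $L^1$} if there are $C_0,\theta>0$ such that for all $\psi\in BV$, $\varphi\in L^1(\mu)$ and $n\ge0$, \[ \Bigl|\int\psi\cdot\varphi\circ T^n\,d\mu-\int\psi\,d\mu\int\varphi\,d\mu\Bigr|\le C_0\|\psi\|_{BV}\|\varphi\|_{L^1(\mu)}e^{-\theta n}. \] It is \emph{exponentially 4-mixing for $BV$ against $L^\infty$} if there are $\theta'>0$ and, for all $\psi_1,\psi_2\in BV$ and $\varphi_1,\varphi_2\in L^\infty(\mu)$, a constant $C'=C'(\psi_1,\psi_2,\varphi_1,\varphi_2)$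 such that for all integers $0\le a<b\le c$, \[ \Bigl|\int\psi_1\cdot\psi_2\circ T^a\cdot\varphi_1\circ T^b\cdot\varphi_2\circ T^c\,d\mu-\int\psi_1\cdot\psi_2\circ T^a\,d\mu\int\varphi_1\cdot\varphi_2\circ T^{c-b}\,d\mu\Bigr|\le C'e^{-\theta'(b-a)}. \] The \emph{short return time estimate} holds with constants $C,s>0$ if \[ \mu(\{x: d(x,T^nx)<r\})\le Cr^s\qquad\text{for all } n\ge1,\ r>0 . \] Below, "decreasing" means non-increasing, and $\lesssim$ means $\le$ up to a multiplicative constant; $\lesssim$ and all pointwise bounds on $r_n$ and $\int\mu(B(x,r_n))\,d\mu(x)$ are required only for all sufficiently large $n$. 1. Suppose $(X,T,\mu)$ is exponentially mixing for $BV$ against $L^1$ and the short return time estimate holds with constants $C,s>0$. If for some function $h(n)\to\infty$ we have $r_n\le \dfrac1{(n\log n)^{1/s}h(n)}$ and $\int\mu(B(x,r_n))\,d\mu(x)\le\dfrac1{n^2h(n)}$, then $\mu(\liminf_nF_{n,r_n})=0$. 2. Suppose $(X,T,\mu)$ is exponentially mixing for $BV$ against $L^1$, the short return time estimate holds with constants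 $C,s>0$, and $r_n\lesssim n^{-1/s}(\log n)^{-2/s-\varepsilon}$ for some $\varepsilon>0$. If $n\int\mu(B(x,r_n))\,d\mu(x)$, $n\ge1$, is decreasing and $\sum_{n=1}^\infty n\int\mu(B(x,r_n))\,d\mu(x)<\infty$, then $\mu(\limsup_nF_{n,r_n})=0$. 3. Suppose $(X,T,\mu)$ is exponentially 4-mixing for $BV$ against $L^\infty$. If $(r_n)_{n\ge1}$ is decreasing, $r_n\ge n^{-\beta}$ for some $\beta>0$, and $\int\mu(B(x,r_n))\,d\mu(x)\ge\dfrac{(\log n)^4(\log\log n)^{2+\varepsilon}}{n^2}$ for some $\varepsilon>0$, then $\mu(\liminf_nF_{n,4r_n})=1$. 4. Suppose $(X,T,\mu)$ is exponentially 4-mixing for $BV$ against $L^\infty$. If $r_n\ge n^{-\beta}$ for some $\beta>0$ and, for some function $h(n)\to\infty$, $\int\mu(B(x,r_n))\,d\mu(x)\ge\dfrac{(\log n)^2h(n)}{n^2}$, then $\mu(\limsup_nF_{n,4r_n})=1$. -/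

import Mathlib

open MeasureTheory Filter Set
open scoped ENNReal Topology

noncomputable section

namespace SingleOrbit

/-- The points whose own orbit up to time `n` has two points within distance `r`:
`d(T^i x, T^j x) < r` for some `0 ≤ i < j < n`. -/
def F {X : Type*} [PseudoMetricSpace X] (T : X → X) (n : ℕ) (r : ℝ) : Set X :=
  {x | ∃ i j : ℕ, i < j ∧ j < n ∧ dist (T^[i] x) (T^[j] x) < r}

/-- The points returning within distance `r` of themselves at time `n`. -/
def shortReturn {X : Type*} [PseudoMetricSpace X] (T : X → X) (r : ℝ) (n : ℕ) : Set X :=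
  {x | dist x (T^[n] x) < r}

/-- The averaged measure of balls, `∫ μ(B(x,r)) dμ(x)`. -/
def ballIntegral {X : Type*} [PseudoMetricSpace X] [MeasurableSpace X]
    (μ : Measure X) (r : ℝ) : ℝ :=
  ∫ x, μ.real (Metric.ball x r) ∂μ

/-- Functions of bounded variation on `X ⊆ ℝ`. -/
def IsBV {X : Set ℝ} (ψ : X → ℝ) : Prop := BoundedVariationOn ψ univ

/-- The norm `sup |ψ| + Var ψ` (a function of bounded variation is bounded). -/
def bvNorm {X : Set ℝ} (ψ : X → ℝ) : ℝ := (⨆ x, |ψ x|) + (eVariationOn ψ univ).toReal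

/-- Exponential mixing for `BV` against `L¹(μ)`. -/
def ExpMixingBVL1 {X : Set ℝ} (T : X → X) (μ : Measure X) : Prop :=
  ∃ C > (0 : ℝ), ∃ θ > (0 : ℝ), ∀ ψ φ : X → ℝ, IsBV ψ → Integrable φ μ → ∀ n : ℕ,
    |(∫ x, ψ x * φ (T^[n] x) ∂μ) - (∫ x, ψ x ∂μ) * ∫ x, φ x ∂μ|
      ≤ C * bvNorm ψ * (∫ x, |φ x| ∂μ) * Real.exp (-θ * n)

/-- Exponential 4-mixing for `BV` against `L^∞(μ)`. The rate `θ` is uniform, the constant `C` is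
allowed to depend on the four observables. -/
def Exp4Mixing {X : Set ℝ} (T : X → X) (μ : Measure X) : Prop :=
  ∃ C : (X → ℝ) → (X → ℝ) → (X → ℝ) → (X → ℝ) → ℝ, ∃ θ > (0 : ℝ),
    ∀ ψ₁ ψ₂ φ₁ φ₂ : X → ℝ, IsBV ψ₁ → IsBV ψ₂ → MemLp φ₁ ∞ μ → MemLp φ₂ ∞ μ →
      ∀ a b c : ℕ, a < b → b ≤ c →
        |(∫ x, ψ₁ x * ψ₂ (T^[a] x) * φ₁ (T^[b] x) * φ₂ (T^[c] x) ∂μ)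
            - (∫ x, ψ₁ x * ψ₂ (T^[a] x) ∂μ) * ∫ x, φ₁ x * φ₂ (T^[c - b] x) ∂μ|
          ≤ C ψ₁ ψ₂ φ₁ φ₂ * Real.exp (-θ * ((b : ℝ) - a))

/-- The short return time estimate `μ {x | d(x, T^n x) < r} ≤ C r^s` for all `n ≥ 1`, `r > 0`. -/
def ShortReturnEstimate {X : Type*} [PseudoMetricSpace X] [MeasurableSpace X]
    (T : X → X) (μ : Measure X) (C s : ℝ) : Prop :=
  ∀ n : ℕ, 1 ≤ n → ∀ r : ℝ, 0 < r → μ.real (shortReturn T r n) ≤ C * r ^ s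

end SingleOrbit

end

open MeasureTheory Filter Set
open scoped ENNReal Topology

noncomputable section

/-! Write b(r) for `ballIntegral μ r`, and M for the sum of the squared measures of the cells of a
grid of mesh δ. M is the probability that two independent points share a cell, and it is comparable
to b(δ) (`tsum_sq_cell_le`, `ballIntegral_le`).

Null sets. A close pair T^i x, T^j x is a return of T^i x after j - i steps. Returns within (3/θ)
log n steps are controlled by the short return estimate, later ones by mixing, under which a point
and its late image behave like independent points. Summing over fewer than n² pairs gives μ(F_{n,r})
≲ n log n · r^s + n² b(r) + 1/n (`measureReal_F_le`). The liminf statement follows by a Fatou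
argument. The limsup statement follows by Borel–Cantelli along powers of two, since the sets of one
dyadic block lie in a single set.

Full measure. With N = ⌊n/3⌋, count the pairs i < N, 2N ≤ j < 3N for which T^i x and T^j x share a
cell; the expected number is about N²M. The second moment involves times i, k in the first block and
j, l in the second. Four-fold mixing across the gap splits it into the correlations of (i, k) and of
(j, l), and only pairs less than g ≍ log n apart fail to be nearly independent. Chebyshev gives
μ(F_{n,4r}ᶜ) ≲ log n / (n √b(r)) (`measureReal_compl_F_le`), and the Fatou or Borel–Cantelli
argument is applied to complements.

The constant in four-fold mixing depends on the observables, whereas the cells vary with n.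
`exists_uniform_mixing_bound` supplies one constant for all dyadic cells at once, by the uniform
boundedness principle. -/

namespace SingleOrbit

/-! ### Grid cells and the averaged measure of balls -/

section


/-- The cell of index `k` of the grid of mesh `δ`. -/
def cell (X : Set ℝ) (δ : ℝ) (k : ℤ) : Set X := {x | ⌊(x : ℝ) / δ⌋ = k}

variable {X : Set ℝ}

lemma measurableSet_cell (δ : ℝ) (k : ℤ) : MeasurableSet (cell X δ k) := by
  have : Measurable fun x : X => ⌊(x : ℝ) / δ⌋ :=
    Int.measurable_floor.comp (measurable_subtype_coe.div_const δ)
  exact this (measurableSet_singleton k)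

lemma pairwise_disjoint_cell (δ : ℝ) : Pairwise (Function.onFun Disjoint (cell X δ)) := by
  intro k l hkl
  refine Set.disjoint_left.2 fun x hx hy => hkl ?_
  exact (show ⌊(x : ℝ) / δ⌋ = k from hx).symm.trans hy

lemma iUnion_cell (δ : ℝ) : ⋃ k, cell X δ k = univ :=
  eq_univ_of_forall fun _ => mem_iUnion.2 ⟨_, rfl⟩

lemma dist_lt_of_mem_cell {δ : ℝ} (hδ : 0 < δ) {k : ℤ} {x y : X} (hx : x ∈ cell X δ k)
    (hy : y ∈ cell X δ k) : dist x y < δ := by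
  have h : |(x : ℝ) / δ - y / δ| < 1 :=
    Int.abs_sub_lt_one_of_floor_eq_floor
      ((show ⌊(x : ℝ) / δ⌋ = k from hx).trans (show ⌊(y : ℝ) / δ⌋ = k from hy).symm)
  rw [← sub_div, abs_div, abs_of_pos hδ, div_lt_one hδ] at h
  rwa [Subtype.dist_eq, Real.dist_eq]

/-- The middle case is written `k + 0` so that the three neighbours are uniformly shifts `k + e`. -/
lemma exists_cell_of_dist_lt {δ : ℝ} (hδ : 0 < δ) {k : ℤ} {x y : X} (hx : x ∈ cell X δ k)
    (hxy : dist x y < δ) :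
    y ∈ cell X δ (k + -1) ∨ y ∈ cell X δ (k + 0) ∨ y ∈ cell X δ (k + 1) := by
  rw [Subtype.dist_eq, Real.dist_eq] at hxy
  have hk : ⌊(x : ℝ) / δ⌋ = k := hx
  have h : |(x : ℝ) / δ - y / δ| < 1 := by
    rwa [← sub_div, abs_div, abs_of_pos hδ, div_lt_one hδ]
  rw [abs_lt] at h
  rw [Int.floor_eq_iff] at hk
  have h1 : ⌊(y : ℝ) / δ⌋ < k + 2 := by
    rw [Int.floor_lt]; push_cast; linarith
  have h2 : k + -1 ≤ ⌊(y : ℝ) / δ⌋ := by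
    rw [Int.le_floor]; push_cast; linarith
  simp only [cell, mem_ofPred_eq]
  omega

/-- The real-valued indicator function of a set. -/
abbrev ind (E : Set X) : X → ℝ := E.indicator 1

lemma eVariationOn_le_of_monotone {f : X → ℝ} (hf : Monotone f) (h0 : ∀ x, 0 ≤ f x)
    (h1 : ∀ x, f x ≤ 1) : eVariationOn f univ ≤ 1 := by
  rw [eVariationOn.eq_biSup_inter_Icc]
  refine iSup_le fun p => iSup_le fun hp => ?_
  refine ((hf.monotoneOn _).eVariationOn_eq hp.1 hp.2.1).trans_le ?_
  rw [← ENNReal.ofReal_one]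
  exact ENNReal.ofReal_le_ofReal (by linarith [h0 p.1, h1 p.2])

lemma eVariationOn_sub_le (f g : X → ℝ) :
    eVariationOn (f - g) univ ≤ eVariationOn f univ + eVariationOn g univ := by
  refine iSup_le fun p => ?_
  calc _ ≤ ∑ i ∈ Finset.range p.1, (edist (f (p.2.1 (i + 1))) (f (p.2.1 i))
          + edist (g (p.2.1 (i + 1))) (g (p.2.1 i))) := by
        refine Finset.sum_le_sum fun i _ => ?_
        simp only [Pi.sub_apply, sub_eq_add_neg]
        refine (edist_add_add_le _ _ _ _).trans ?_
        rw [edist_neg_neg]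
    _ ≤ _ := by
        rw [Finset.sum_add_distrib]
        exact add_le_add (eVariationOn.sum_le p.2.2.1 p.2.2.2)
          (eVariationOn.sum_le p.2.2.1 p.2.2.2)

/-- A cell is the difference of two nested right half-lines, whose indicators are monotone with
values in [0, 1]. -/
lemma eVariationOn_ind_cell_le {δ : ℝ} (hδ : 0 < δ) (k : ℤ) :
    eVariationOn (ind (cell X δ k)) univ ≤ 2 := by
  have hfl : Monotone fun x : X => ⌊(x : ℝ) / δ⌋ := fun x y h =>
    Int.floor_mono (div_le_div_of_nonneg_right h hδ.le)
  have hm : ∀ l : ℤ, eVariationOn (ind {x : X | l ≤ ⌊(x : ℝ) / δ⌋}) univ ≤ 1 := by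
    intro l
    refine eVariationOn_le_of_monotone ?_ ?_ ?_
    · intro x y h
      by_cases hx : l ≤ ⌊(x : ℝ) / δ⌋
      · have hy : l ≤ ⌊(y : ℝ) / δ⌋ := hx.trans (hfl h)
        simp [hx, hy]
      · simp only [indicator, mem_ofPred_eq, hx, if_false]
        split_ifs <;> simp
    · exact fun x => indicator_nonneg (fun _ _ => zero_le_one) x
    · exact fun x => indicator_le_self' (fun _ _ => zero_le_one) x
  have : ind (cell X δ k)
      = ind {x : X | k ≤ ⌊(x : ℝ) / δ⌋} - ind {x : X | k + 1 ≤ ⌊(x : ℝ) / δ⌋} := by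
    ext x
    simp only [cell, Pi.sub_apply, indicator, mem_ofPred_eq, Pi.one_apply]
    split_ifs <;> first | omega | simp
  rw [this]
  refine (eVariationOn_sub_le _ _).trans ((add_le_add (hm _) (hm _)).trans ?_)
  norm_num

lemma ind_nonneg (E : Set X) (x : X) : 0 ≤ ind E x :=
  indicator_nonneg (fun _ _ => zero_le_one) x

lemma ind_le_one (E : Set X) (x : X) : ind E x ≤ 1 :=
  indicator_le_self' (fun _ _ => zero_le_one) x

lemma abs_ind_le_one (E : Set X) (x : X) : |ind E x| ≤ 1 := by
  rw [abs_of_nonneg (ind_nonneg E x)]; exact ind_le_one E x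

lemma isBV_ind_cell {δ : ℝ} (hδ : 0 < δ) (k : ℤ) : IsBV (ind (cell X δ k)) :=
  ne_top_of_le_ne_top (by simp) (eVariationOn_ind_cell_le hδ k)

lemma bvNorm_ind_cell_le {δ : ℝ} (hδ : 0 < δ) (k : ℤ) : bvNorm (ind (cell X δ k)) ≤ 3 := by
  have h1 : (⨆ x, |ind (cell X δ k) x|) ≤ 1 :=
    Real.iSup_le (abs_ind_le_one _) zero_le_one
  have h2 : (eVariationOn (ind (cell X δ k)) univ).toReal ≤ 2 :=
    ENNReal.toReal_le_of_le_ofReal (by norm_num)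
      (by simpa using eVariationOn_ind_cell_le hδ k)
  unfold bvNorm
  linarith

variable {μ : Measure X} [IsProbabilityMeasure μ]

/-- Countable additivity of `μ.real` over the cells. -/
lemma hasSum_measureReal_inter_cell (δ : ℝ) (S : Set X) :
    HasSum (fun k => μ.real (S ∩ cell X δ k)) (μ.real S) := by
  have h : ∑' k, μ (S ∩ cell X δ k) = μ S := by
    have := measure_iUnion (μ := μ.restrict S) (pairwise_disjoint_cell δ)
      (measurableSet_cell (X := X) δ)
    rw [iUnion_cell, Measure.restrict_apply_univ] at this
    rw [this]
    exact tsum_congr fun k => by rw [Measure.restrict_apply (measurableSet_cell δ k), inter_comm]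
  have h' := ENNReal.hasSum_toReal (f := fun k => μ (S ∩ cell X δ k)) (by simp [h])
  rwa [← ENNReal.tsum_toReal_eq (fun _ => measure_ne_top _ _), h] at h'

lemma hasSum_measureReal_cell (δ : ℝ) : HasSum (fun k => μ.real (cell X δ k)) 1 := by
  simpa using hasSum_measureReal_inter_cell (μ := μ) δ univ

lemma measurable_measureReal_ball (r : ℝ) :
    Measurable fun x : X => μ.real (Metric.ball x r) := by
  have h : MeasurableSet {p : X × X | dist p.2 p.1 < r} :=
    measurableSet_lt (measurable_snd.dist measurable_fst) measurable_const
  exact (measurable_measure_prodMk_left h).ennreal_toReal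

lemma integrable_measureReal_ball (r : ℝ) :
    Integrable (fun x : X => μ.real (Metric.ball x r)) μ :=
  Integrable.of_bound (measurable_measureReal_ball r).aestronglyMeasurable 1
    (Eventually.of_forall fun x => by
      rw [Real.norm_of_nonneg measureReal_nonneg]; exact measureReal_le_one)

lemma ballIntegral_mono {r s : ℝ} (h : r ≤ s) : ballIntegral μ r ≤ ballIntegral μ s :=
  integral_mono (integrable_measureReal_ball r) (integrable_measureReal_ball s) fun _ =>
    measureReal_mono (Metric.ball_subset_ball h)

lemma ballIntegral_nonneg {ν : Measure X} (r : ℝ) : 0 ≤ ballIntegral ν r :=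
  integral_nonneg fun _ => measureReal_nonneg

lemma ballIntegral_le_one (r : ℝ) : ballIntegral μ r ≤ 1 := by
  refine (integral_mono (integrable_measureReal_ball r) (integrable_const 1) fun _ =>
    measureReal_le_one).trans ?_
  simp

lemma hasSum_setIntegral_cell (δ r : ℝ) :
    HasSum (fun k => ∫ x in cell X δ k, μ.real (Metric.ball x r) ∂μ) (ballIntegral μ r) := by
  have := hasSum_integral_iUnion (μ := μ) (f := fun x : X => μ.real (Metric.ball x r))
    (fun k => measurableSet_cell (X := X) δ k) (pairwise_disjoint_cell δ)
    (integrable_measureReal_ball r).integrableOn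
  rwa [iUnion_cell, setIntegral_univ] at this

lemma summable_mul_cell (δ : ℝ) (e : ℤ) :
    Summable fun k => μ.real (cell X δ k) * μ.real (cell X δ (k + e)) :=
  Summable.of_nonneg_of_le (fun _ => mul_nonneg measureReal_nonneg measureReal_nonneg)
    (fun _ => mul_le_of_le_one_right measureReal_nonneg measureReal_le_one)
    (hasSum_measureReal_cell δ).summable

lemma summable_sq_cell (δ : ℝ) : Summable fun k => μ.real (cell X δ k) ^ 2 := by
  simpa [sq] using summable_mul_cell (μ := μ) δ 0

/-- AM–GM termwise, then translation invariance of the sum over ℤ. -/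
lemma tsum_mul_shift_le {a : ℤ → ℝ} (hs : Summable fun k => a k ^ 2) (e : ℤ)
    (hm : Summable fun k => a k * a (k + e)) : ∑' k, a k * a (k + e) ≤ ∑' k, a k ^ 2 := by
  have hse : Summable fun k => a (k + e) ^ 2 := (Equiv.addRight e).summable_iff.2 hs
  have he : ∑' k, a (k + e) ^ 2 = ∑' k, a k ^ 2 :=
    (Equiv.addRight e).tsum_eq fun k => a k ^ 2
  have h : ∑' k, a k * a (k + e) ≤ ∑' k, (a k ^ 2 + a (k + e) ^ 2) / 2 :=
    hm.tsum_le_tsum (fun k => by nlinarith [sq_nonneg (a k - a (k + e))])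
      ((hs.add hse).div_const 2)
  rw [tsum_div_const, hs.tsum_add hse, he] at h
  linarith

lemma tsum_mul_cell_le (δ : ℝ) (e : ℤ) :
    ∑' k, μ.real (cell X δ k) * μ.real (cell X δ (k + e)) ≤ ∑' k, μ.real (cell X δ k) ^ 2 :=
  tsum_mul_shift_le (summable_sq_cell δ) e (summable_mul_cell δ e)

lemma tsum_sq_cell_le {δ : ℝ} (hδ : 0 < δ) :
    ∑' k, μ.real (cell X δ k) ^ 2 ≤ ballIntegral μ δ := by
  rw [← (hasSum_setIntegral_cell (μ := μ) δ δ).tsum_eq]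
  refine (summable_sq_cell δ).tsum_le_tsum (fun k => ?_) (hasSum_setIntegral_cell δ δ).summable
  have : ∫ x in cell X δ k, μ.real (cell X δ k) ∂μ = μ.real (cell X δ k) ^ 2 := by
    simp [sq]
  rw [← this]
  refine setIntegral_mono_on (by simp) (integrable_measureReal_ball δ).integrableOn
    (measurableSet_cell δ k) fun x hx => measureReal_mono fun y hy => ?_
  exact dist_lt_of_mem_cell hδ hy hx

lemma measureReal_le_three {A B₁ B₂ B₃ : Set X}
    (h : A ⊆ B₁ ∪ (B₂ ∪ B₃)) : μ.real A ≤ μ.real B₁ + (μ.real B₂ + μ.real B₃) :=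
  (measureReal_mono h).trans <| (measureReal_union_le _ _).trans <|
    by gcongr; exact measureReal_union_le _ _

/-- A ball of radius at most δ centred in a cell meets only that cell and its two neighbours, and
neighbour products are dominated by squares. -/
lemma ballIntegral_le {r δ : ℝ} (hδ : 0 < δ) (hr : r ≤ δ) :
    ballIntegral μ r ≤ 3 * ∑' k, μ.real (cell X δ k) ^ 2 := by
  have hs := fun e => summable_mul_cell (μ := μ) δ e
  have h1 : ballIntegral μ r ≤ ∑' k, (μ.real (cell X δ k) * μ.real (cell X δ (k + -1))
      + (μ.real (cell X δ k) * μ.real (cell X δ (k + 0))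
        + μ.real (cell X δ k) * μ.real (cell X δ (k + 1)))) := by
    rw [← (hasSum_setIntegral_cell (μ := μ) δ r).tsum_eq]
    refine (hasSum_setIntegral_cell δ r).summable.tsum_le_tsum (fun k => ?_)
      ((hs _).add ((hs _).add (hs _)))
    have : ∫ x in cell X δ k, (μ.real (cell X δ (k + -1)) + (μ.real (cell X δ (k + 0))
        + μ.real (cell X δ (k + 1)))) ∂μ = μ.real (cell X δ k) * μ.real (cell X δ (k + -1))
      + (μ.real (cell X δ k) * μ.real (cell X δ (k + 0))
        + μ.real (cell X δ k) * μ.real (cell X δ (k + 1))) := by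
      rw [setIntegral_const, smul_eq_mul]; ring
    rw [← this]
    refine setIntegral_mono_on (integrable_measureReal_ball r).integrableOn (by simp)
      (measurableSet_cell δ k) fun x hx => measureReal_le_three fun y hy => ?_
    refine exists_cell_of_dist_lt hδ hx ?_
    rw [dist_comm]
    exact lt_of_lt_of_le hy hr
  rw [(hs _).tsum_add ((hs _).add (hs _)), (hs _).tsum_add (hs _)] at h1
  have h2 := fun e => tsum_mul_cell_le (μ := μ) δ e
  linarith [h2 (-1), h2 0, h2 1]

lemma ballIntegral_pos {r : ℝ} (hr : 0 < r) : 0 < ballIntegral μ r := by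
  obtain ⟨k, hk⟩ : ∃ k, μ.real (cell X r k) ≠ 0 := by
    by_contra! h
    have := (hasSum_measureReal_cell (μ := μ) r).tsum_eq
    simp [h] at this
  exact lt_of_lt_of_le ((summable_sq_cell r).tsum_pos (fun _ => sq_nonneg _) k (by positivity))
    (tsum_sq_cell_le hr)

end

/-! ### Exponential mixing against L¹: the null sets -/

section


variable {X : Set ℝ} {μ : Measure X} [IsProbabilityMeasure μ] {T : X → X}

lemma measureReal_inter_preimage_le (hT : MeasurePreserving T μ μ) {C θ : ℝ} (hC : 0 < C)
    (hmix : ∀ ψ φ : X → ℝ, IsBV ψ → Integrable φ μ → ∀ n : ℕ,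
      |(∫ x, ψ x * φ (T^[n] x) ∂μ) - (∫ x, ψ x ∂μ) * ∫ x, φ x ∂μ|
        ≤ C * bvNorm ψ * (∫ x, |φ x| ∂μ) * Real.exp (-θ * n))
    {δ : ℝ} (hδ : 0 < δ) (k l : ℤ) (n : ℕ) :
    μ.real (cell X δ k ∩ T^[n] ⁻¹' cell X δ l) ≤ μ.real (cell X δ k) * μ.real (cell X δ l)
      + 3 * C * Real.exp (-θ * n) * μ.real (cell X δ l) := by
  have hk := measurableSet_cell (X := X) δ k
  have hl := measurableSet_cell (X := X) δ l
  have hint : ∀ E : Set X, MeasurableSet E → ∫ x, ind E x ∂μ = μ.real E := fun E hE => by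
    rw [integral_indicator_one hE]
  have h := hmix (ind (cell X δ k)) (ind (cell X δ l)) (isBV_ind_cell hδ k)
    ((integrable_const (1 : ℝ)).indicator hl) n
  have e1 : ∫ x, ind (cell X δ k) x * ind (cell X δ l) (T^[n] x) ∂μ
      = μ.real (cell X δ k ∩ T^[n] ⁻¹' cell X δ l) := by
    rw [← hint _ (hk.inter ((hT.iterate n).measurable hl))]
    congr 1; ext x
    simp only [indicator, mem_inter_iff, mem_preimage]
    by_cases h1 : x ∈ cell X δ k <;> by_cases h2 : T^[n] x ∈ cell X δ l <;> simp [h1, h2]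
  have e2 : ∫ x, |ind (cell X δ l) x| ∂μ = μ.real (cell X δ l) := by
    rw [← hint _ hl]
    exact integral_congr_ae (Eventually.of_forall fun x => abs_of_nonneg (ind_nonneg _ x))
  rw [e1, e2, hint _ hk, hint _ hl] at h
  have h3 : C * bvNorm (ind (cell X δ k)) * μ.real (cell X δ l) * Real.exp (-θ * n)
      ≤ C * 3 * μ.real (cell X δ l) * Real.exp (-θ * n) := by
    gcongr; exact bvNorm_ind_cell_le hδ k
  linarith [(abs_le.1 h).2]

/-- The error carries the factor `p l`, which comes from the L¹ norm of the second observable. It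
therefore sums to `η` over infinitely many cells, once for each of the three shifts. -/
lemma le_of_cover_of_mixing {p f : ℤ → ℝ} {b : ℤ → ℤ → ℝ} {η c : ℝ} (hp : HasSum p 1)
    (hm : ∀ e, Summable fun k => p k * p (k + e))
    (hle : ∀ e, ∑' k, p k * p (k + e) ≤ ∑' k, p k ^ 2) (hf : HasSum f c)
    (hfb : ∀ k, f k ≤ b k (k + -1) + (b k (k + 0) + b k (k + 1)))
    (hb : ∀ k l, b k l ≤ p k * p l + η * p l) : c ≤ 3 * ∑' k, p k ^ 2 + 3 * η := by
  have hq : ∀ e : ℤ, HasSum (fun k => p k * p (k + e) + η * p (k + e))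
      (∑' k, p k * p (k + e) + η * 1) := fun e =>
    (hm e).hasSum.add (((Equiv.addRight e).hasSum_iff.2 hp).mul_left η)
  have key := hasSum_le (fun k => (hfb k).trans (add_le_add (hb _ _) (add_le_add (hb _ _) (hb _ _))))
    hf ((hq (-1)).add ((hq 0).add (hq 1)))
  linarith [hle (-1), hle 0, hle 1]

/-- Under exponential mixing, returns at time `n` are controlled by the averaged measure of balls,
up to an exponentially small error. -/
lemma measureReal_shortReturn_le (hT : MeasurePreserving T μ μ) (hmix : ExpMixingBVL1 T μ) :
    ∃ C > (0 : ℝ), ∃ θ > (0 : ℝ), ∀ (n : ℕ) (r : ℝ), 0 < r →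
      μ.real (shortReturn T r n) ≤ 3 * ballIntegral μ r + C * Real.exp (-θ * n) := by
  obtain ⟨C, hC, θ, hθ, hmix⟩ := hmix
  refine ⟨9 * C, by positivity, θ, hθ, fun n r hr => ?_⟩
  have key := le_of_cover_of_mixing (η := 3 * C * Real.exp (-θ * n))
    (hasSum_measureReal_cell (μ := μ) r)
    (summable_mul_cell r) (tsum_mul_cell_le r)
    (hasSum_measureReal_inter_cell (μ := μ) r (shortReturn T r n))
    (b := fun k l => μ.real (cell X r k ∩ T^[n] ⁻¹' cell X r l)) (fun k => ?_)
    (fun k l => measureReal_inter_preimage_le hT hC hmix hr k l n)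
  · have := tsum_sq_cell_le (μ := μ) hr
    linarith
  · refine measureReal_le_three ?_
    rintro x ⟨hx, hxk⟩
    rcases exists_cell_of_dist_lt hr hxk hx with h | h | h
    · exact Or.inl ⟨hxk, h⟩
    · exact Or.inr (Or.inl ⟨hxk, h⟩)
    · exact Or.inr (Or.inr ⟨hxk, h⟩)

lemma measurableSet_shortReturn (hT : Measurable T) (r : ℝ) (n : ℕ) :
    MeasurableSet (shortReturn T r n) :=
  measurableSet_lt (measurable_id.dist (hT.iterate n)) measurable_const

lemma measureReal_F_le_sum (hT : MeasurePreserving T μ μ) (n : ℕ) (r : ℝ) :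
    μ.real (F T n r) ≤ n * ∑ m ∈ Finset.Ico 1 n, μ.real (shortReturn T r m) := by
  have hsub : F T n r ⊆ ⋃ i ∈ Finset.range n, ⋃ m ∈ Finset.Ico 1 n,
      T^[i] ⁻¹' shortReturn T r m := by
    rintro x ⟨i, j, hij, hj, hd⟩
    simp only [mem_iUnion, Finset.mem_range, Finset.mem_Ico]
    refine ⟨i, by omega, j - i, by omega, ?_⟩
    change dist (T^[i] x) (T^[j - i] (T^[i] x)) < r
    rwa [← Function.iterate_add_apply, Nat.sub_add_cancel hij.le]
  refine (measureReal_mono hsub (measure_ne_top _ _)).trans ?_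
  refine (measureReal_biUnion_finset_le _ _).trans ?_
  calc _ ≤ ∑ i ∈ Finset.range n, ∑ m ∈ Finset.Ico 1 n, μ.real (shortReturn T r m) := by
        refine Finset.sum_le_sum fun i _ => (measureReal_biUnion_finset_le _ _).trans ?_
        refine Finset.sum_le_sum fun m _ => le_of_eq ?_
        exact (hT.iterate i).measureReal_preimage
          (measurableSet_shortReturn hT.measurable r m).nullMeasurableSet
    _ = _ := by simp

/-- Return times are cut at (3/θ) log n. Beyond it the mixing error is at most a constant times n⁻³,
so fewer than n² pairs contribute O(1/n). -/
lemma measureReal_F_le (hT : MeasurePreserving T μ μ) (hmix : ExpMixingBVL1 T μ) {C s : ℝ}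
    (hC : 0 < C) (hret : ShortReturnEstimate T μ C s) :
    ∃ D > (0 : ℝ), ∀ (n : ℕ) (r : ℝ), 2 ≤ n → 0 < r →
      μ.real (F T n r) ≤
        D * (n * Real.log n * r ^ s + (n : ℝ) ^ 2 * ballIntegral μ r + 1 / n) := by
  obtain ⟨C', hC', θ, hθ, hmix⟩ := measureReal_shortReturn_le hT hmix
  refine ⟨max (3 / θ * C) (max 3 C'), by positivity, fun n r hn hr => ?_⟩
  set D := max (3 / θ * C) (max 3 C')
  have hn0 : (0 : ℝ) < n := by positivity
  have hlog : 0 ≤ Real.log n := Real.log_natCast_nonneg n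
  have hb := ballIntegral_nonneg (ν := μ) r
  have hrs : 0 < r ^ s := Real.rpow_pos_of_pos hr s
  set t := 3 / θ * Real.log n with ht
  have ht0 : 0 ≤ t := by positivity
  have hterm : ∀ m ∈ Finset.Ico 1 n, μ.real (shortReturn T r m)
      ≤ (if m ≤ ⌊t⌋₊ then C * r ^ s else 0) + (3 * ballIntegral μ r + C' * (1 / n) ^ 3) := by
    intro m hm
    rw [Finset.mem_Ico] at hm
    split_ifs with h
    · have := hret m hm.1 r hr
      have : 0 ≤ C' * (1 / (n : ℝ)) ^ 3 := by positivity
      linarith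
    · rw [zero_add]
      refine (hmix m r hr).trans ?_
      have h1 : t < m := (Nat.floor_lt ht0).1 (not_le.1 h)
      have h2 : Real.exp (-θ * m) ≤ (1 / n) ^ 3 := by
        have : (1 / (n : ℝ)) ^ 3 = Real.exp (-(3 * Real.log n)) := by
          rw [Real.exp_neg, mul_comm, Real.exp_mul, Real.exp_log hn0]
          norm_num
        rw [this]
        refine Real.exp_le_exp.2 ?_
        have h3 : 3 * Real.log n = θ * t := by rw [ht]; field_simp
        rw [h3]
        nlinarith
      gcongr
  refine (measureReal_F_le_sum hT n r).trans ?_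
  have hsum : ∑ m ∈ Finset.Ico 1 n, μ.real (shortReturn T r m)
      ≤ t * (C * r ^ s) + n * (3 * ballIntegral μ r + C' * (1 / n) ^ 3) := by
    refine (Finset.sum_le_sum hterm).trans ?_
    rw [Finset.sum_add_distrib, ← Finset.sum_filter, Finset.sum_const, Finset.sum_const,
      nsmul_eq_mul, nsmul_eq_mul]
    gcongr
    · have hsub : (Finset.Ico 1 n).filter (· ≤ ⌊t⌋₊) ⊆ Finset.Icc 1 ⌊t⌋₊ := by
        intro m hm
        simp only [Finset.mem_filter, Finset.mem_Ico] at hm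
        exact Finset.mem_Icc.2 ⟨hm.1.1, hm.2⟩
      have := Finset.card_le_card hsub
      rw [Nat.card_Icc, Nat.add_sub_cancel] at this
      exact (Nat.cast_le.2 this).trans (Nat.floor_le ht0)
    · simp
  have h1 : (3 / θ * C) * (n * Real.log n * r ^ s) ≤ D * (n * Real.log n * r ^ s) := by
    gcongr; exact le_max_left _ _
  have h2 : 3 * ((n : ℝ) ^ 2 * ballIntegral μ r) ≤ D * ((n : ℝ) ^ 2 * ballIntegral μ r) := by
    gcongr; exact (le_max_left _ _).trans (le_max_right _ _)
  have h3 : C' * (1 / n) ≤ D * (1 / (n : ℝ)) := by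
    gcongr; exact (le_max_right _ _).trans (le_max_right _ _)
  calc _ ≤ n * (t * (C * r ^ s) + n * (3 * ballIntegral μ r + C' * (1 / n) ^ 3)) := by gcongr
    _ = (3 / θ * C) * (n * Real.log n * r ^ s) + 3 * ((n : ℝ) ^ 2 * ballIntegral μ r)
        + C' * (1 / n) := by rw [ht]; field_simp; ring
    _ ≤ _ := by linarith

/-- A Fatou-type lemma: the limit inferior of sets of vanishing measure is null. -/
lemma measure_liminf_eq_zero {Y : Type*} [MeasurableSpace Y] {ν : Measure Y} [IsFiniteMeasure ν]
    {s : ℕ → Set Y} {a : ℕ → ℝ} (h : ∀ᶠ n in atTop, ν.real (s n) ≤ a n)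
    (ha : Tendsto a atTop (𝓝 0)) : ν (liminf s atTop) = 0 := by
  have hreal : Tendsto (fun n => ν.real (s n)) atTop (𝓝 0) :=
    squeeze_zero' (Eventually.of_forall fun _ => measureReal_nonneg) h ha
  rw [liminf_eq_iSup_iInf_of_nat]
  simp only [iSup_eq_iUnion, iInf_eq_iInter]
  refine measure_iUnion_null fun n => ?_
  rw [← measureReal_eq_zero_iff]
  refine le_antisymm (ge_of_tendsto hreal ?_) measureReal_nonneg
  filter_upwards [eventually_ge_atTop n] with m hm
  exact measureReal_mono (iInter₂_subset m hm) (measure_ne_top _ _)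

theorem measure_liminf_F_eq_zero (hT : MeasurePreserving T μ μ) (hmix : ExpMixingBVL1 T μ)
    {C s : ℝ} (hC : 0 < C) (hs : 0 < s) (hret : ShortReturnEstimate T μ C s) {r h : ℕ → ℝ}
    (hr : ∀ n, 1 ≤ n → 0 < r n) (hh : Tendsto h atTop atTop)
    (hrh : ∀ᶠ n : ℕ in atTop, r n ≤ 1 / (((n : ℝ) * Real.log n) ^ (1 / s) * h n))
    (hbh : ∀ᶠ n : ℕ in atTop, ballIntegral μ (r n) ≤ 1 / ((n : ℝ) ^ 2 * h n)) :
    μ (liminf (fun n => F T n (r n)) atTop) = 0 := by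
  obtain ⟨D, hD, hF⟩ := measureReal_F_le hT hmix hC hret
  refine measure_liminf_eq_zero
    (a := fun n : ℕ => D * ((h n) ^ (-s) + (h n)⁻¹ + 1 / (n : ℝ))) ?_ ?_
  · filter_upwards [hrh, hbh, hh.eventually_gt_atTop 0, eventually_ge_atTop 2]
      with n h1 h2 h3 h4
    refine (hF n (r n) h4 (hr n (by omega))).trans ?_
    have hn : (0 : ℝ) < n := by positivity
    have hlog : 0 < Real.log n := Real.log_pos (by exact_mod_cast h4)
    gcongr
    · calc n * Real.log n * r n ^ s
          ≤ n * Real.log n * (1 / (((n : ℝ) * Real.log n) ^ (1 / s) * h n)) ^ s := by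
            gcongr; exact (hr n (by omega)).le
        _ = h n ^ (-s) := by
            rw [one_div, Real.inv_rpow (by positivity), Real.mul_rpow (by positivity) h3.le,
              ← Real.rpow_mul (by positivity), one_div_mul_cancel hs.ne', Real.rpow_one,
              Real.rpow_neg h3.le]
            field_simp
    · calc (n : ℝ) ^ 2 * ballIntegral μ (r n) ≤ (n : ℝ) ^ 2 * (1 / ((n : ℝ) ^ 2 * h n)) := by gcongr
        _ = (h n)⁻¹ := by field_simp
  · have e1 : Tendsto (fun n => h n ^ (-s)) atTop (𝓝 0) := (tendsto_rpow_neg_atTop hs).comp hh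
    have e2 : Tendsto (fun n => (h n)⁻¹) atTop (𝓝 0) := tendsto_inv_atTop_zero.comp hh
    have := ((e1.add e2).add tendsto_one_div_atTop_nhds_zero_nat).const_mul D
    simpa using this

/-- Borel–Cantelli for real-valued bounds. -/
lemma measure_limsup_eq_zero_of_summable {Y : Type*} [MeasurableSpace Y] {ν : Measure Y}
    [IsFiniteMeasure ν] {s : ℕ → Set Y} {a : ℕ → ℝ} (h : ∀ᶠ n in atTop, ν.real (s n) ≤ a n)
    (ha : Summable a) : ν (limsup s atTop) = 0 := by
  have hsum : Summable fun n => ν.real (s n) :=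
    summable_of_isBigO_nat' ha (Asymptotics.IsBigO.of_bound 1 (by
      filter_upwards [h] with n hn
      rw [Real.norm_of_nonneg measureReal_nonneg, one_mul]
      exact hn.trans (le_abs_self _)))
  refine measure_limsup_atTop_eq_zero ?_
  have : ∀ n, ν (s n) = ENNReal.ofReal (ν.real (s n)) := fun n => (ofReal_measureReal).symm
  simp_rw [this]
  exact hsum.tsum_ofReal_ne_top

lemma F_mono {Y : Type*} [PseudoMetricSpace Y] (S : Y → Y) {m n : ℕ} {a b : ℝ} (hmn : m ≤ n)
    (hab : a ≤ b) : F S m a ⊆ F S n b := by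
  rintro x ⟨i, j, hij, hj, hd⟩
  exact ⟨i, j, hij, by omega, by linarith⟩

/-- If m < n and r_m < r_n, then 0 < b(r_m) ≤ b(r_n) would make n b(r_n) exceed m b(r_m). This gives
the monotonicity of the radii needed for dyadic blocking. -/
lemma antitoneOn_of_antitoneOn_mul_ballIntegral {r : ℕ → ℝ} (hr : ∀ n, 1 ≤ n → 0 < r n)
    (hanti : AntitoneOn (fun n : ℕ => (n : ℝ) * ballIntegral μ (r n)) (Ici 1)) :
    AntitoneOn r (Ici 1) := by
  intro m hm n hn hmn
  rcases hmn.eq_or_lt with rfl | hlt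
  · exact le_rfl
  by_contra! hlt'
  have h1 := hanti hm hn hmn
  have h2 := ballIntegral_mono (μ := μ) hlt'.le
  have h3 := ballIntegral_pos (μ := μ) (hr m hm)
  have h4 : (m : ℝ) < n := by exact_mod_cast hlt
  simp only at h1
  nlinarith [Nat.cast_nonneg (α := ℝ) m, Nat.cast_nonneg (α := ℝ) n]

lemma two_pow_natLog_le_and_le {n : ℕ} (hn : 1 ≤ n) : 2 ^ Nat.log 2 n ≤ n ∧ n ≤ 2 ^ (Nat.log 2 n + 1) :=
  ⟨Nat.pow_log_le_self 2 (by omega), (Nat.lt_pow_succ_log_self one_lt_two n).le⟩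

lemma tendsto_natLog_atTop : Tendsto (Nat.log 2) atTop atTop :=
  tendsto_atTop_atTop.2 fun b => ⟨2 ^ b, fun _ h => Nat.le_log_of_pow_le one_lt_two h⟩

lemma tendsto_two_pow_atTop : Tendsto (fun k : ℕ => 2 ^ k) atTop atTop :=
  tendsto_pow_atTop_atTop_of_one_lt one_lt_two

theorem measure_limsup_F_eq_zero (hT : MeasurePreserving T μ μ) (hmix : ExpMixingBVL1 T μ)
    {C s ε : ℝ} (hC : 0 < C) (hs : 0 < s) (hε : 0 < ε) (hret : ShortReturnEstimate T μ C s)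
    {r : ℕ → ℝ} (hr : ∀ n, 1 ≤ n → 0 < r n) {K : ℝ}
    (hK : ∀ᶠ n : ℕ in atTop,
        r n ≤ K * ((n : ℝ) ^ (-(1 / s)) * Real.log n ^ (-(2 / s) - ε)))
    (hanti : AntitoneOn (fun n : ℕ => (n : ℝ) * ballIntegral μ (r n)) (Ici 1))
    (hsum : Summable (fun n : ℕ => (n : ℝ) * ballIntegral μ (r n))) :
    μ (limsup (fun n => F T n (r n)) atTop) = 0 := by
  obtain ⟨D, hD, hF⟩ := measureReal_F_le hT hmix hC hret
  have hra := antitoneOn_of_antitoneOn_mul_ballIntegral hr hanti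
  have hsub : limsup (fun n => F T n (r n)) atTop
      ⊆ limsup (fun k => F T (2 ^ (k + 1)) (r (2 ^ k))) atTop := by
    intro x hx
    rw [mem_limsup_iff_frequently_mem] at hx ⊢
    -- Infinitely many n give infinitely many k = ⌊log₂ n⌋, because this index tends to infinity.
    refine tendsto_natLog_atTop.frequently (hx.and_eventually (eventually_ge_atTop 1) |>.mono ?_)
    rintro n ⟨hxn, hn⟩
    have h := two_pow_natLog_le_and_le hn
    exact F_mono T h.2 (hra Nat.one_le_two_pow hn h.1) hxn
  refine measure_mono_null hsub ?_
  -- Cauchy condensation turns the summability of n b(r_n) into that of 4^k b(r_{2^k}), the main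
  -- term at n = 2^(k+1) up to a constant.
  have hcond : Summable fun k : ℕ => (2 : ℝ) ^ k * (((2 ^ k : ℕ) : ℝ) * ballIntegral μ (r (2 ^ k))) :=
    (summable_condensed_iff_of_nonneg (f := fun n : ℕ => (n : ℝ) * ballIntegral μ (r n))
      (fun n => mul_nonneg (Nat.cast_nonneg n) (ballIntegral_nonneg _))
      (fun m n hm hmn => hanti hm (hm.trans_le hmn) hmn)).2 hsum
  have hpow : Summable fun k : ℕ => (k : ℝ) ^ (-(1 + ε * s)) :=
    Real.summable_nat_rpow.2 (by nlinarith)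
  have hgeom : Summable fun k : ℕ => ((1 : ℝ) / 2) ^ k := summable_geometric_two
  refine measure_limsup_eq_zero_of_summable (a := fun k : ℕ =>
    D * (4 * (|K| ^ s * Real.log 2 ^ (-(1 + ε * s))) * (k : ℝ) ^ (-(1 + ε * s))
      + 4 * ((2 : ℝ) ^ k * (((2 ^ k : ℕ) : ℝ) * ballIntegral μ (r (2 ^ k))))
      + (1 / 2) ^ k)) ?_
    ((((hpow.mul_left _).add (hcond.mul_left 4)).add hgeom).mul_left D)
  filter_upwards [tendsto_two_pow_atTop.eventually hK, eventually_ge_atTop 1] with k hk hk1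
  have hr0 := hr (2 ^ k) Nat.one_le_two_pow
  refine (hF (2 ^ (k + 1)) (r (2 ^ k)) (by
    calc 2 = 2 ^ 1 := rfl
      _ ≤ 2 ^ (k + 1) := Nat.pow_le_pow_right (by norm_num) (by omega)) hr0).trans ?_
  have hl2 : 0 < Real.log 2 := Real.log_pos one_lt_two
  have hk0 : (0 : ℝ) < k := by exact_mod_cast hk1
  have hk1' : (1 : ℝ) ≤ k := by exact_mod_cast hk1
  push_cast at hk ⊢
  rw [Real.log_pow] at hk ⊢
  refine mul_le_mul_of_nonneg_left (add_le_add (add_le_add ?_ ?_) ?_) hD.le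
  · set L := (k : ℝ) * Real.log 2 with hL
    have hL0 : 0 < L := by positivity
    have h1 : r (2 ^ k) ^ s ≤ |K| ^ s * (((2 : ℝ) ^ k)⁻¹ * L ^ (-(2 + ε * s))) := by
      have h2 : r (2 ^ k) ≤ |K| * (((2 : ℝ) ^ k) ^ (-(1 / s)) * L ^ (-(2 / s) - ε)) :=
        hk.trans (by gcongr; exact le_abs_self K)
      refine (Real.rpow_le_rpow hr0.le h2 hs.le).trans (le_of_eq ?_)
      rw [Real.mul_rpow (abs_nonneg _) (by positivity), Real.mul_rpow (by positivity) (by positivity),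
        ← Real.rpow_mul (by positivity), ← Real.rpow_mul hL0.le]
      congr 2
      · rw [neg_mul, one_div_mul_cancel hs.ne', Real.rpow_neg_one]
      · congr 1; field_simp; ring
    have h3 : ((k + 1 : ℕ) : ℝ) * Real.log 2 ≤ 2 * L := by
      rw [hL]; push_cast; nlinarith
    have h4 : L * L ^ (-(2 + ε * s)) = L ^ (-(1 + ε * s)) := by
      rw [← Real.rpow_one_add' hL0.le (by nlinarith)]; congr 1; ring
    calc (2 : ℝ) ^ (k + 1) * (((k + 1 : ℕ) : ℝ) * Real.log 2) * r (2 ^ k) ^ s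
        ≤ 2 ^ (k + 1) * (2 * L) * (|K| ^ s * (((2 : ℝ) ^ k)⁻¹ * L ^ (-(2 + ε * s)))) := by gcongr
      _ = 4 * |K| ^ s * (L * L ^ (-(2 + ε * s))) := by rw [pow_succ]; field_simp; ring
      _ = _ := by rw [h4, hL, Real.mul_rpow hk0.le hl2.le]; ring
  · apply le_of_eq; rw [pow_succ]; ring
  · rw [one_div, one_div, inv_pow, pow_succ]
    gcongr
    have : (0 : ℝ) < 2 ^ k := by positivity
    linarith

end

/-! ### Uniform constants in four-fold mixing -/

section


/-- The uniform boundedness principle on `ℓ¹`, in coordinates. -/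
lemma exists_bound_of_pairing_bounded {ι α : Type*} (c : α → ι → ℝ)
    (hc : ∀ a, ∃ K, ∀ i, |c a i| ≤ K)
    (h : ∀ u : ι → ℝ, Summable (fun i => |u i|) → ∃ C, ∀ a, |∑' i, u i * c a i| ≤ C) :
    ∃ C, ∀ a i, |c a i| ≤ C := by
  classical
  have hsum : ∀ u : lp (fun _ : ι => ℝ) 1, Summable fun i => |u i| := fun u => by
    have := (memℓp_gen_iff (p := 1) (by simp)).1 u.2
    simpa using this
  have hnorm : ∀ u : lp (fun _ : ι => ℝ) 1, ‖u‖ = ∑' i, |u i| := fun u => by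
    rw [lp.norm_eq_tsum_rpow (by simp) u]
    simp
  have hsc : ∀ (a : α) (u : lp (fun _ : ι => ℝ) 1), Summable fun i => u i * c a i := fun a u => by
    obtain ⟨K, hK⟩ := hc a
    refine Summable.of_norm_bounded ((hsum u).mul_right K) fun i => ?_
    rw [Real.norm_eq_abs, abs_mul]
    exact mul_le_mul_of_nonneg_left (hK i) (abs_nonneg _)
  choose K hK using hc
  let L : α → lp (fun _ : ι => ℝ) 1 →ₗ[ℝ] ℝ := fun a =>
    { toFun := fun u => ∑' i, u i * c a i
      map_add' := fun u v => by
        rw [← (hsc a u).tsum_add (hsc a v)]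
        exact tsum_congr fun i => by simp [add_mul]
      map_smul' := fun t u => by
        simp only [RingHom.id_apply, smul_eq_mul]
        rw [← tsum_mul_left]
        exact tsum_congr fun i => by simp [mul_assoc] }
  let G : α → lp (fun _ : ι => ℝ) 1 →L[ℝ] ℝ := fun a => (L a).mkContinuous (K a) fun u => by
    change ‖∑' i, u i * c a i‖ ≤ K a * ‖u‖
    rw [hnorm, ← tsum_mul_left]
    refine (norm_tsum_le_tsum_norm (hsc a u).norm).trans ?_
    refine (hsc a u).norm.tsum_le_tsum (fun i => ?_) ((hsum u).mul_left _)
    rw [Real.norm_eq_abs, abs_mul, mul_comm]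
    exact mul_le_mul_of_nonneg_right (hK a i) (abs_nonneg _)
  obtain ⟨C, hC⟩ := banach_steinhaus (g := G) fun u => h u (hsum u)
  refine ⟨C, fun a i => ?_⟩
  -- Each coordinate is the value of the functional at a basis vector of norm one.
  have h1 : G a (lp.single 1 i (1 : ℝ)) = c a i := by
    change ∑' j, (lp.single 1 i (1 : ℝ) : ι → ℝ) j * c a j = c a i
    rw [tsum_eq_single i fun j hj => by simp [hj]]
    simp
  have h2 := (G a).le_of_opNorm_le (hC a) (lp.single 1 i (1 : ℝ))
  rw [h1, lp.norm_single (by simp)] at h2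
  simpa using h2

variable {X : Set ℝ} {ι : Type*} {E : ι → Set X}

/-- The combination `∑ uᵢ 1_{Eᵢ}` of indicator functions. -/
def comb (E : ι → Set X) (u : ι → ℝ) (x : X) : ℝ := ∑' i, u i * ind (E i) x

lemma summable_mul_ind {u : ι → ℝ} (hu : Summable fun i => |u i|) (x : X) :
    Summable fun i => u i * ind (E i) x :=
  Summable.of_norm_bounded hu fun i => by
    rw [Real.norm_eq_abs, abs_mul]
    exact mul_le_of_le_one_right (abs_nonneg _) (abs_ind_le_one _ _)

lemma abs_comb_le {u : ι → ℝ} (hu : Summable fun i => |u i|) (x : X) :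
    |comb E u x| ≤ ∑' i, |u i| := by
  have hs := (summable_mul_ind (E := E) hu x).norm
  refine (norm_tsum_le_tsum_norm hs).trans (hs.tsum_le_tsum (fun i => ?_) hu)
  rw [Real.norm_eq_abs, abs_mul]
  exact mul_le_of_le_one_right (abs_nonneg _) (abs_ind_le_one _ _)

lemma measurable_ind {A : Set X} (hA : MeasurableSet A) : Measurable (ind A) :=
  measurable_one.indicator hA

lemma measurable_comb [Countable ι] (hE : ∀ i, MeasurableSet (E i)) (u : ι → ℝ) :
    Measurable (comb E u) := by
  have h : ∀ i, Measurable fun x => u i * ind (E i) x := fun i =>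
    (measurable_ind (hE i)).const_mul (u i)
  exact Measurable.tsum h

/-- Variation is countably subadditive, so ℓ¹ coefficients and a common bound on the variations
suffice. Combinations are thus admissible observables in the mixing hypothesis. -/
lemma isBV_comb (hV : ∀ i, eVariationOn (ind (E i)) univ ≤ 2) {u : ι → ℝ}
    (hu : Summable fun i => |u i|) : IsBV (comb E u) := by
  have hfin : ∑' i, ENNReal.ofReal |u i| * 2 ≠ ∞ := by
    rw [ENNReal.tsum_mul_right]
    exact ENNReal.mul_ne_top hu.tsum_ofReal_ne_top (by simp)
  refine ne_top_of_le_ne_top hfin (iSup_le fun p => ?_)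
  have hed : ∀ x y, edist (comb E u x) (comb E u y)
      ≤ ∑' i, ENNReal.ofReal |u i| * edist (ind (E i) x) (ind (E i) y) := by
    intro x y
    have hs : Summable fun i => u i * ind (E i) x - u i * ind (E i) y :=
      (summable_mul_ind hu x).sub (summable_mul_ind hu y)
    have h1 : comb E u x - comb E u y = ∑' i, (u i * ind (E i) x - u i * ind (E i) y) :=
      ((summable_mul_ind hu x).tsum_sub (summable_mul_ind hu y)).symm
    rw [edist_eq_enorm_sub, h1]
    refine (enorm_tsum_le_tsum_enorm).trans (ENNReal.tsum_le_tsum fun i => ?_)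
    rw [edist_eq_enorm_sub, ← mul_sub, enorm_mul, ← Real.enorm_eq_ofReal_abs]
  calc _ ≤ ∑ k ∈ Finset.range p.1, ∑' i, ENNReal.ofReal |u i|
          * edist (ind (E i) (p.2.1 (k + 1))) (ind (E i) (p.2.1 k)) :=
        Finset.sum_le_sum fun k _ => hed _ _
    _ = ∑' i, ENNReal.ofReal |u i| * ∑ k ∈ Finset.range p.1,
          edist (ind (E i) (p.2.1 (k + 1))) (ind (E i) (p.2.1 k)) := by
        rw [← Summable.tsum_finsetSum fun _ _ => ENNReal.summable]
        exact tsum_congr fun i => (Finset.mul_sum _ _ _).symm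
    _ ≤ _ := ENNReal.tsum_le_tsum fun i => by
        gcongr
        exact (eVariationOn.sum_le p.2.2.1 p.2.2.2).trans (hV i)

/-- A functional is countably linear along the family `E` of sets. -/
def CountablyLinear (E : ι → Set X) (Λ : (X → ℝ) → ℝ) : Prop :=
  (∀ u : ι → ℝ, Summable (fun i => |u i|) → Λ (comb E u) = ∑' i, u i * Λ (ind (E i))) ∧
    ∃ K, ∀ i, |Λ (ind (E i))| ≤ K

lemma CountablyLinear.summable {Λ : (X → ℝ) → ℝ} (h : CountablyLinear E Λ) {u : ι → ℝ}
    (hu : Summable fun i => |u i|) : Summable fun i => u i * Λ (ind (E i)) := by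
  obtain ⟨K, hK⟩ := h.2
  refine Summable.of_norm_bounded (hu.mul_right K) fun i => ?_
  rw [Real.norm_eq_abs, abs_mul]
  exact mul_le_mul_of_nonneg_left (hK i) (abs_nonneg _)

lemma CountablyLinear.const_mul {Λ : (X → ℝ) → ℝ} (h : CountablyLinear E Λ) (c : ℝ) :
    CountablyLinear E fun ψ => c * Λ ψ := by
  refine ⟨fun u hu => ?_, ?_⟩
  · simp only [h.1 u hu]
    rw [← tsum_mul_left]
    exact tsum_congr fun i => by ring
  · obtain ⟨K, hK⟩ := h.2
    refine ⟨|c| * K, fun i => ?_⟩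
    rw [abs_mul]
    exact mul_le_mul_of_nonneg_left (hK i) (abs_nonneg _)

lemma CountablyLinear.sub {Λ Γ : (X → ℝ) → ℝ} (h : CountablyLinear E Λ)
    (h' : CountablyLinear E Γ) : CountablyLinear E fun ψ => Λ ψ - Γ ψ := by
  refine ⟨fun u hu => ?_, ?_⟩
  · simp only [h.1 u hu, h'.1 u hu]
    rw [← (h.summable hu).tsum_sub (h'.summable hu)]
    exact tsum_congr fun i => by ring
  · obtain ⟨K, hK⟩ := h.2
    obtain ⟨K', hK'⟩ := h'.2
    exact ⟨K + K', fun i => (abs_sub _ _).trans (add_le_add (hK i) (hK' i))⟩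

lemma CountablyLinear.exists_bound {α : Type*} {Λ : α → (X → ℝ) → ℝ}
    (hΛ : ∀ a, CountablyLinear E (Λ a))
    (h : ∀ u : ι → ℝ, Summable (fun i => |u i|) → ∃ C, ∀ a, |Λ a (comb E u)| ≤ C) :
    ∃ C, ∀ a i, |Λ a (ind (E i))| ≤ C := by
  refine exists_bound_of_pairing_bounded (fun a i => Λ a (ind (E i))) (fun a => (hΛ a).2) ?_
  intro u hu
  obtain ⟨C, hC⟩ := h u hu
  exact ⟨C, fun a => by rw [← (hΛ a).1 u hu]; exact hC a⟩

/-- Bounded measurable functions. -/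
def BddMeas (f : X → ℝ) : Prop := Measurable f ∧ ∃ B, ∀ x, |f x| ≤ B

lemma BddMeas.mul {f g : X → ℝ} (hf : BddMeas f) (hg : BddMeas g) :
    BddMeas fun x => f x * g x := by
  obtain ⟨hf, B, hB⟩ := hf
  obtain ⟨hg, B', hB'⟩ := hg
  refine ⟨hf.mul hg, B * B', fun x => ?_⟩
  rw [abs_mul]
  exact mul_le_mul (hB x) (hB' x) (abs_nonneg _) ((abs_nonneg _).trans (hB x))

lemma BddMeas.comp {f : X → ℝ} (hf : BddMeas f) {S : X → X} (hS : Measurable S) :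
    BddMeas fun x => f (S x) :=
  ⟨hf.1.comp hS, hf.2.imp fun _ h x => h (S x)⟩

lemma bddMeas_ind {A : Set X} (hA : MeasurableSet A) : BddMeas (ind A) :=
  ⟨measurable_ind hA, 1, abs_ind_le_one A⟩

lemma bddMeas_comb [Countable ι] (hE : ∀ i, MeasurableSet (E i)) {u : ι → ℝ}
    (hu : Summable fun i => |u i|) : BddMeas (comb E u) :=
  ⟨measurable_comb hE u, _, abs_comb_le hu⟩

variable {μ : Measure X} [IsProbabilityMeasure μ]

lemma BddMeas.memLp_top {ν : Measure X} {f : X → ℝ} (hf : BddMeas f) : MemLp f ∞ ν :=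
  hf.2.elim fun B hB => memLp_top_of_bound hf.1.aestronglyMeasurable B (Eventually.of_forall hB)

lemma BddMeas.integrable {f : X → ℝ} (hf : BddMeas f) : Integrable f μ :=
  hf.memLp_top.integrable le_top

lemma countablyLinear_integral [Countable ι] (hE : ∀ i, MeasurableSet (E i)) {S : X → X}
    (hS : Measurable S) {f : X → ℝ} (hf : BddMeas f) :
    CountablyLinear E fun ψ => ∫ x, ψ (S x) * f x ∂μ := by
  obtain ⟨B, hB⟩ := hf.2
  have hbd : ∀ i x, ‖ind (E i) (S x) * f x‖ ≤ B := fun i x => by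
    rw [Real.norm_eq_abs, abs_mul]
    exact (mul_le_of_le_one_left (abs_nonneg _) (abs_ind_le_one _ _)).trans (hB x)
  refine ⟨fun u hu => ?_, B, fun i => ?_⟩
  · have hmeas : ∀ i, BddMeas fun x => ind (E i) (S x) * f x := fun i =>
      ((bddMeas_ind (hE i)).comp hS).mul hf
    have key := hasSum_integral_of_summable_integral_norm (μ := μ)
      (F := fun i x => u i * (ind (E i) (S x) * f x))
      (fun i => (hmeas i).integrable.const_mul (u i)) ?_
    · have h1 := key.tsum_eq
      simp only [integral_const_mul] at h1
      rw [h1]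
      refine integral_congr_ae (Eventually.of_forall fun x => ?_)
      simp only [comb]
      rw [← tsum_mul_right]
      exact tsum_congr fun i => by ring
    · refine Summable.of_nonneg_of_le (fun i => integral_nonneg fun _ => norm_nonneg _)
        (fun i => ?_) (hu.mul_right B)
      refine (integral_mono ((hmeas i).integrable.const_mul (u i)).norm
        (integrable_const (|u i| * B)) fun x => ?_).trans (by simp)
      simp only [norm_mul (u i), Real.norm_eq_abs (u i)]
      exact mul_le_mul_of_nonneg_left (hbd i x) (abs_nonneg _)
  · simpa using norm_integral_le_of_norm_le_const (μ := μ) (Eventually.of_forall (hbd i))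

/-- The correlation defect in four-fold mixing. -/
def defect (T : X → X) (μ : Measure X) (a b c : ℕ) (ψ₁ ψ₂ φ₁ φ₂ : X → ℝ) : ℝ :=
  (∫ x, ψ₁ x * ψ₂ (T^[a] x) * φ₁ (T^[b] x) * φ₂ (T^[c] x) ∂μ)
    - (∫ x, ψ₁ x * ψ₂ (T^[a] x) ∂μ) * ∫ x, φ₁ x * φ₂ (T^[c - b] x) ∂μ

section

variable {T : X → X} [Countable ι] (hE : ∀ i, MeasurableSet (E i)) (hT : Measurable T) (a b c : ℕ)
  {f g h : X → ℝ} (hf : BddMeas f) (hg : BddMeas g) (hh : BddMeas h)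

include hE hT hf hg hh

lemma countablyLinear_defect₁ :
    CountablyLinear E fun ψ => defect T μ a b c ψ f g h := by
  have h1 := countablyLinear_integral (μ := μ) hE measurable_id
    (((hf.comp (hT.iterate a)).mul (hg.comp (hT.iterate b))).mul (hh.comp (hT.iterate c)))
  have h2 := countablyLinear_integral (μ := μ) hE measurable_id (hf.comp (hT.iterate a))
  convert h1.sub (h2.const_mul (∫ x, g x * h (T^[c - b] x) ∂μ)) using 2 with ψ
  simp only [defect, id, mul_assoc, mul_comm]

lemma countablyLinear_defect₂ :
    CountablyLinear E fun ψ => defect T μ a b c f ψ g h := by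
  have h1 := countablyLinear_integral (μ := μ) hE (hT.iterate a)
    ((hf.mul (hg.comp (hT.iterate b))).mul (hh.comp (hT.iterate c)))
  have h2 := countablyLinear_integral (μ := μ) hE (hT.iterate a) hf
  convert h1.sub (h2.const_mul (∫ x, g x * h (T^[c - b] x) ∂μ)) using 2 with ψ
  simp only [defect, mul_assoc, mul_comm, mul_left_comm]

lemma countablyLinear_defect₃ :
    CountablyLinear E fun ψ => defect T μ a b c f g ψ h := by
  have h1 := countablyLinear_integral (μ := μ) hE (hT.iterate b)
    ((hf.mul (hg.comp (hT.iterate a))).mul (hh.comp (hT.iterate c)))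
  have h2 := countablyLinear_integral (μ := μ) hE measurable_id (hh.comp (hT.iterate (c - b)))
  convert h1.sub (h2.const_mul (∫ x, f x * g (T^[a] x) ∂μ)) using 2 with ψ
  simp only [defect, id, mul_assoc, mul_left_comm]

lemma countablyLinear_defect₄ :
    CountablyLinear E fun ψ => defect T μ a b c f g h ψ := by
  have h1 := countablyLinear_integral (μ := μ) hE (hT.iterate c)
    ((hf.mul (hg.comp (hT.iterate a))).mul (hh.comp (hT.iterate b)))
  have h2 := countablyLinear_integral (μ := μ) hE (hT.iterate (c - b)) hh
  convert h1.sub (h2.const_mul (∫ x, f x * g (T^[a] x) ∂μ)) using 2 with ψ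
  simp only [defect, mul_assoc, mul_comm]

end

/-- The constant in four-fold mixing is uniform over a countable family of indicator functions. -/
theorem exists_uniform_mixing_bound {T : X → X} [Countable ι] (hE : ∀ i, MeasurableSet (E i))
    (hV : ∀ i, eVariationOn (ind (E i)) univ ≤ 2) (hT : Measurable T) (hmix : Exp4Mixing T μ) :
    ∃ C > (0 : ℝ), ∃ θ > (0 : ℝ), ∀ (i j k l : ι) (a b c : ℕ), a < b → b ≤ c →
      |defect T μ a b c (ind (E i)) (ind (E j)) (ind (E k)) (ind (E l))|
        ≤ C * Real.exp (-θ * ((b : ℝ) - a)) := by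
  obtain ⟨C, θ, hθ, hmix⟩ := hmix
  let A := {t : ℕ × ℕ × ℕ // t.1 < t.2.1 ∧ t.2.1 ≤ t.2.2}
  -- Weighting by the inverse rate turns exponential decay into boundedness over all admissible
  -- times, the input of the uniform boundedness principle.
  let w : A → ℝ := fun t => Real.exp (θ * ((t.1.2.1 : ℝ) - t.1.1))
  let D : A → (X → ℝ) → (X → ℝ) → (X → ℝ) → (X → ℝ) → ℝ := fun t ψ₁ ψ₂ φ₁ φ₂ =>
    w t * defect T μ t.1.1 t.1.2.1 t.1.2.2 ψ₁ ψ₂ φ₁ φ₂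
  have hc : ∀ {u : ι → ℝ}, Summable (fun i => |u i|) → BddMeas (comb E u) := bddMeas_comb hE
  have he : ∀ i, BddMeas (ind (E i)) := fun i => bddMeas_ind (hE i)
  have s0 : ∀ u₁ u₂ u₃ u₄ : ι → ℝ, Summable (fun i => |u₁ i|) → Summable (fun i => |u₂ i|) →
      Summable (fun i => |u₃ i|) → Summable (fun i => |u₄ i|) →
      ∃ C, ∀ t, |D t (comb E u₁) (comb E u₂) (comb E u₃) (comb E u₄)| ≤ C := by
    intro u₁ u₂ u₃ u₄ h₁ h₂ h₃ h₄
    refine ⟨C (comb E u₁) (comb E u₂) (comb E u₃) (comb E u₄), fun t => ?_⟩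
    have := hmix _ _ _ _ (isBV_comb hV h₁) (isBV_comb hV h₂) (hc h₃).memLp_top (hc h₄).memLp_top
      t.1.1 t.1.2.1 t.1.2.2 t.2.1 t.2.2
    rw [abs_mul, abs_of_pos (Real.exp_pos _)]
    refine (mul_le_mul_of_nonneg_left this (Real.exp_pos _).le).trans (le_of_eq ?_)
    rw [mul_left_comm, ← Real.exp_add]
    simp
  -- The four slots are treated one at a time. Once a slot holds an indicator, its index joins the
  -- parameter set of the family of functionals in the next slot.
  have s1 : ∀ u₂ u₃ u₄ : ι → ℝ, Summable (fun i => |u₂ i|) →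
      Summable (fun i => |u₃ i|) → Summable (fun i => |u₄ i|) →
      ∃ C, ∀ (t : A) (i : ι), |D t (ind (E i)) (comb E u₂) (comb E u₃) (comb E u₄)| ≤ C :=
    fun u₂ u₃ u₄ h₂ h₃ h₄ => CountablyLinear.exists_bound
      (Λ := fun (t : A) ψ => D t ψ (comb E u₂) (comb E u₃) (comb E u₄))
      (fun t => (countablyLinear_defect₁ hE hT _ _ _ (hc h₂) (hc h₃) (hc h₄)).const_mul _)
      fun u₁ h₁ => s0 u₁ u₂ u₃ u₄ h₁ h₂ h₃ h₄
  have s2 : ∀ u₃ u₄ : ι → ℝ, Summable (fun i => |u₃ i|) → Summable (fun i => |u₄ i|) →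
      ∃ C, ∀ (t : A × ι) (i : ι),
        |D t.1 (ind (E t.2)) (ind (E i)) (comb E u₃) (comb E u₄)| ≤ C :=
    fun u₃ u₄ h₃ h₄ => CountablyLinear.exists_bound
      (Λ := fun (t : A × ι) ψ => D t.1 (ind (E t.2)) ψ (comb E u₃) (comb E u₄))
      (fun t => (countablyLinear_defect₂ hE hT _ _ _ (he _) (hc h₃) (hc h₄)).const_mul _)
      fun u₂ h₂ => (s1 u₂ u₃ u₄ h₂ h₃ h₄).imp fun _ h t => h t.1 t.2
  have s3 : ∀ u₄ : ι → ℝ, Summable (fun i => |u₄ i|) →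
      ∃ C, ∀ (t : (A × ι) × ι) (i : ι),
        |D t.1.1 (ind (E t.1.2)) (ind (E t.2)) (ind (E i)) (comb E u₄)| ≤ C :=
    fun u₄ h₄ => CountablyLinear.exists_bound
      (Λ := fun (t : (A × ι) × ι) ψ => D t.1.1 (ind (E t.1.2)) (ind (E t.2)) ψ (comb E u₄))
      (fun t => (countablyLinear_defect₃ hE hT _ _ _ (he _) (he _) (hc h₄)).const_mul _)
      fun u₃ h₃ => (s2 u₃ u₄ h₃ h₄).imp fun _ h t => h t.1 t.2
  obtain ⟨C', hC'⟩ : ∃ C, ∀ (t : ((A × ι) × ι) × ι) (i : ι),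
      |D t.1.1.1 (ind (E t.1.1.2)) (ind (E t.1.2)) (ind (E t.2)) (ind (E i))| ≤ C :=
    CountablyLinear.exists_bound
      (Λ := fun (t : ((A × ι) × ι) × ι) ψ =>
        D t.1.1.1 (ind (E t.1.1.2)) (ind (E t.1.2)) (ind (E t.2)) ψ)
      (fun t => (countablyLinear_defect₄ hE hT _ _ _ (he _) (he _) (he _)).const_mul _)
      fun u₄ h₄ => (s3 u₄ h₄).imp fun _ h t => h t.1 t.2
  refine ⟨max C' 1, by positivity, θ, hθ, fun i j k l a b c hab hbc => ?_⟩
  have := hC' (((⟨(a, b, c), hab, hbc⟩, i), j), k) l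
  simp only [D, w, abs_mul, abs_of_pos (Real.exp_pos _)] at this
  rw [neg_mul, Real.exp_neg, ← div_eq_mul_inv, le_div_iff₀' (Real.exp_pos _)]
  exact this.trans (le_max_left _ _)

end

/-! ### Second moment of the number of coincidences -/

section


section Coupling

variable {κ : Type*} {K : Finset κ} {P : κ → ℝ} {m m' : κ → κ → ℝ}

/-- In the application `P` lists the cell measures and `m` is the joint law of the cells visited at
two times, restricted to finitely many cells; hence marginals are bounded by `P`. -/
lemma sum_sq_le_sum_sq_marginal (hm : ∀ p q, 0 ≤ m p q) (hmP : ∀ p q, m p q ≤ P p)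
    (h₁ : ∀ p, ∑ q ∈ K, m p q ≤ P p) :
    ∑ p ∈ K, ∑ q ∈ K, m p q ^ 2 ≤ ∑ p ∈ K, P p ^ 2 := by
  refine Finset.sum_le_sum fun p _ => ?_
  have hP : 0 ≤ P p := (hm p p).trans (hmP p p)
  calc ∑ q ∈ K, m p q ^ 2 ≤ ∑ q ∈ K, P p * m p q := by
        refine Finset.sum_le_sum fun q _ => ?_
        rw [sq]
        exact mul_le_mul_of_nonneg_right (hmP p q) (hm p q)
    _ = P p * ∑ q ∈ K, m p q := (Finset.mul_sum _ _ _).symm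
    _ ≤ P p ^ 2 := by rw [sq]; exact mul_le_mul_of_nonneg_left (h₁ p) hP

lemma sum_mul_le_sum_sq_marginal (hm : ∀ p q, 0 ≤ m p q) (hmP : ∀ p q, m p q ≤ P p)
    (h₁ : ∀ p, ∑ q ∈ K, m p q ≤ P p) (hm' : ∀ p q, 0 ≤ m' p q) (hmP' : ∀ p q, m' p q ≤ P p)
    (h₁' : ∀ p, ∑ q ∈ K, m' p q ≤ P p) :
    ∑ p ∈ K, ∑ q ∈ K, m p q * m' p q ≤ ∑ p ∈ K, P p ^ 2 := by
  have h : ∑ p ∈ K, ∑ q ∈ K, m p q * m' p q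
      ≤ ∑ p ∈ K, ∑ q ∈ K, (1 / 2 * m p q ^ 2 + 1 / 2 * m' p q ^ 2) :=
    Finset.sum_le_sum fun p _ => Finset.sum_le_sum fun q _ => by
      nlinarith [sq_nonneg (m p q - m' p q)]
  simp only [Finset.sum_add_distrib, ← Finset.mul_sum] at h
  linarith [sum_sq_le_sum_sq_marginal hm hmP h₁, sum_sq_le_sum_sq_marginal hm' hmP' h₁']

/-- AM–GM on `P p * P q` and the marginal bounds reduce the sum to that of the cubes of `P`, and
each `P p` is at most the square root of the sum of squares. -/
lemma sum_mul_marginals_le (hm : ∀ p q, 0 ≤ m p q)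
    (h₁ : ∀ p, ∑ q ∈ K, m p q ≤ P p) (h₂ : ∀ q, ∑ p ∈ K, m p q ≤ P q) :
    ∑ p ∈ K, ∑ q ∈ K, m p q * (P p * P q)
      ≤ (∑ p ∈ K, P p ^ 2) * √(∑ p ∈ K, P p ^ 2) := by
  set M := ∑ p ∈ K, P p ^ 2
  have hPM : ∀ p ∈ K, P p ≤ √M := fun p hp =>
    Real.le_sqrt_of_sq_le (Finset.single_le_sum (f := fun p => P p ^ 2)
      (fun _ _ => sq_nonneg _) hp)
  have hcube : ∑ p ∈ K, P p ^ 2 * P p ≤ M * √M := by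
    rw [Finset.sum_mul]
    exact Finset.sum_le_sum fun p hp => mul_le_mul_of_nonneg_left (hPM p hp) (sq_nonneg _)
  have e1 : ∑ p ∈ K, ∑ q ∈ K, P p ^ 2 * m p q ≤ ∑ p ∈ K, P p ^ 2 * P p :=
    Finset.sum_le_sum fun p _ => by
      rw [← Finset.mul_sum]; exact mul_le_mul_of_nonneg_left (h₁ p) (sq_nonneg _)
  have e2 : ∑ p ∈ K, ∑ q ∈ K, P q ^ 2 * m p q ≤ ∑ p ∈ K, P p ^ 2 * P p := by
    rw [Finset.sum_comm]
    exact Finset.sum_le_sum fun p _ => by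
      rw [← Finset.mul_sum]; exact mul_le_mul_of_nonneg_left (h₂ p) (sq_nonneg _)
  have h : ∑ p ∈ K, ∑ q ∈ K, m p q * (P p * P q)
      ≤ ∑ p ∈ K, ∑ q ∈ K, (1 / 2 * (P p ^ 2 * m p q) + 1 / 2 * (P q ^ 2 * m p q)) :=
    Finset.sum_le_sum fun p _ => Finset.sum_le_sum fun q _ => by
      nlinarith [mul_nonneg (hm p q) (sq_nonneg (P p - P q))]
  simp only [Finset.sum_add_distrib, ← Finset.mul_sum] at h
  simp only [← Finset.mul_sum] at e1 e2
  linarith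

lemma sum_mul_le_of_far {η : ℝ} (hη : 0 ≤ η) {a b : κ → κ → ℝ} (ha : ∀ p q, 0 ≤ a p q)
    (ha1 : ∀ p q, a p q ≤ 1) (hfar : ∀ p q, b p q ≤ P p * P q + η) :
    ∑ p ∈ K, ∑ q ∈ K, a p q * b p q
      ≤ ∑ p ∈ K, ∑ q ∈ K, a p q * (P p * P q) + η * (K.card : ℝ) ^ 2 := by
  have h : ∑ p ∈ K, ∑ q ∈ K, a p q * b p q
      ≤ ∑ p ∈ K, ∑ q ∈ K, (a p q * (P p * P q) + η) :=
    Finset.sum_le_sum fun p _ => Finset.sum_le_sum fun q _ => by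
      nlinarith [mul_le_mul_of_nonneg_left (hfar p q) (ha p q), ha1 p q,
        mul_le_mul_of_nonneg_right (ha1 p q) hη]
  refine h.trans (le_of_eq ?_)
  simp only [Finset.sum_add_distrib, Finset.sum_const, nsmul_eq_mul]
  ring

/-- `c` and `c'` say that the two times of a pair are close. With M the sum of squares, the main
term is M when both pairs are close, M√M when one is, and M² when neither is; each far pair costs
one error `η` per pair of cells. -/
lemma sum_mul_le_of_coupling {η : ℝ} (hη : 0 ≤ η) (hP1 : ∀ p, P p ≤ 1)
    (hm : ∀ p q, 0 ≤ m p q) (hmP : ∀ p q, m p q ≤ P p)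
    (h₁ : ∀ p, ∑ q ∈ K, m p q ≤ P p) (h₂ : ∀ q, ∑ p ∈ K, m p q ≤ P q)
    (hm' : ∀ p q, 0 ≤ m' p q) (hmP' : ∀ p q, m' p q ≤ P p)
    (h₁' : ∀ p, ∑ q ∈ K, m' p q ≤ P p) (h₂' : ∀ q, ∑ p ∈ K, m' p q ≤ P q)
    {c c' : Prop} [Decidable c] [Decidable c']
    (hc : ¬ c → ∀ p q, m p q ≤ P p * P q + η) (hc' : ¬ c' → ∀ p q, m' p q ≤ P p * P q + η) :
    ∑ p ∈ K, ∑ q ∈ K, m p q * m' p q ≤ (∑ p ∈ K, P p ^ 2) ^ 2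
      + (if c then 1 else 0) * ((∑ p ∈ K, P p ^ 2) * √(∑ p ∈ K, P p ^ 2))
      + (if c' then 1 else 0) * ((∑ p ∈ K, P p ^ 2) * √(∑ p ∈ K, P p ^ 2))
      + (if c then 1 else 0) * (if c' then 1 else 0) * (∑ p ∈ K, P p ^ 2)
      + 2 * η * (K.card : ℝ) ^ 2 := by
  have hP : ∀ p, 0 ≤ P p := fun p => (hm p p).trans (hmP p p)
  have hk : 0 ≤ η * (K.card : ℝ) ^ 2 := by positivity
  have hM : 0 ≤ ∑ p ∈ K, P p ^ 2 := Finset.sum_nonneg fun _ _ => sq_nonneg _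
  have hMs : 0 ≤ (∑ p ∈ K, P p ^ 2) * √(∑ p ∈ K, P p ^ 2) := mul_nonneg hM (Real.sqrt_nonneg _)
  have hM2 := sq_nonneg (∑ p ∈ K, P p ^ 2)
  have hm1 : ∀ p q, m p q ≤ 1 := fun p q => (hmP p q).trans (hP1 p)
  have hm1' : ∀ p q, m' p q ≤ 1 := fun p q => (hmP' p q).trans (hP1 p)
  by_cases hcc : c
  · by_cases hcc' : c'
    · have := sum_mul_le_sum_sq_marginal hm hmP h₁ hm' hmP' h₁'
      simp only [hcc, hcc', if_true]
      linarith
    · have h := sum_mul_le_of_far (K := K) hη hm hm1 (hc' hcc')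
      have := sum_mul_marginals_le hm h₁ h₂
      simp only [hcc, hcc', if_true, if_false]
      linarith
  · have h := sum_mul_le_of_far (K := K) hη hm' hm1' (hc hcc)
    simp only [mul_comm (m' _ _) (m _ _)] at h
    by_cases hcc' : c'
    · have := sum_mul_marginals_le hm' h₁' h₂'
      simp only [hcc, hcc', if_true, if_false]
      linarith
    · have h3 := sum_mul_le_of_far (K := K) (P := P) (a := fun p q => P p * P q) hη
        (fun p q => mul_nonneg (hP p) (hP q))
        (fun p q => mul_le_one₀ (hP1 p) (hP q) (hP1 q)) (hc' hcc')
      simp only [mul_comm (P _ * P _) (m' _ _)] at h3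
      have h4 : ∑ p ∈ K, ∑ q ∈ K, P p * P q * (P p * P q) = (∑ p ∈ K, P p ^ 2) ^ 2 := by
        rw [sq, Finset.sum_mul_sum]
        exact Finset.sum_congr rfl fun p _ => Finset.sum_congr rfl fun q _ => by ring
      rw [h4] at h3
      simp only [hcc, hcc', if_false]
      linarith

end Coupling

lemma sum_near_le (A : Finset ℕ) (g : ℕ) :
    ∑ i ∈ A, ∑ k ∈ A, (if i < k + g ∧ k < i + g then (1 : ℝ) else 0) ≤ 2 * g * A.card := by
  calc _ ≤ ∑ i ∈ A, (2 * g : ℝ) := by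
        refine Finset.sum_le_sum fun i _ => ?_
        rw [Finset.sum_boole]
        have hsub : A.filter (fun k => i < k + g ∧ k < i + g) ⊆ Finset.Ico (i + 1 - g) (i + g) := by
          intro k hk
          simp only [Finset.mem_filter] at hk
          exact Finset.mem_Ico.2 (by omega)
        have := Finset.card_le_card hsub
        rw [Nat.card_Ico] at this
        exact_mod_cast this.trans (by omega)
    _ = _ := by simp [mul_comm]

section SecondMoment

variable {Ω κ : Type*} [MeasurableSpace Ω] {μ : Measure Ω} [IsProbabilityMeasure μ]
  {χ : ℕ → κ → Ω → ℝ}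

lemma integrable_of_mem_unitInterval {f : Ω → ℝ} (hf : Measurable f) (h0 : ∀ x, 0 ≤ f x)
    (h1 : ∀ x, f x ≤ 1) : Integrable f μ :=
  Integrable.of_bound hf.aestronglyMeasurable 1 (Eventually.of_forall fun x => by
    rw [Real.norm_of_nonneg (h0 x)]; exact h1 x)

variable {K : Finset κ} {P : κ → ℝ} {A B : Finset ℕ} {g N : ℕ} {η : ℝ}

lemma sum_reorder (f : ℕ → ℕ → κ → ℕ → ℕ → κ → ℝ) :
    ∑ i ∈ A, ∑ j ∈ B, ∑ p ∈ K, ∑ k ∈ A, ∑ l ∈ B, ∑ q ∈ K, f i j p k l q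
      = ∑ i ∈ A, ∑ k ∈ A, ∑ j ∈ B, ∑ l ∈ B, ∑ p ∈ K, ∑ q ∈ K, f i j p k l q := by
  refine Finset.sum_congr rfl fun i _ => ?_
  rw [Finset.sum_comm]
  calc _ = ∑ j ∈ B, ∑ k ∈ A, ∑ l ∈ B, ∑ p ∈ K, ∑ q ∈ K, f i j p k l q := by
        rw [Finset.sum_comm]
        refine Finset.sum_congr rfl fun j _ => ?_
        rw [Finset.sum_comm]
        exact Finset.sum_congr rfl fun k _ => Finset.sum_comm
    _ = _ := Finset.sum_comm

/-- The number of coincidences, in the sets indexed by `K`, between times in `A` and in `B`. -/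
def coincidences (χ : ℕ → κ → Ω → ℝ) (K : Finset κ) (A B : Finset ℕ) (x : Ω) : ℝ :=
  ∑ i ∈ A, ∑ j ∈ B, ∑ p ∈ K, χ i p x * χ j p x

lemma coincidences_sq {Y : Type*} {χ : ℕ → κ → Y → ℝ} (x : Y) : coincidences χ K A B x ^ 2
    = ∑ i ∈ A, ∑ k ∈ A, ∑ j ∈ B, ∑ l ∈ B, ∑ p ∈ K, ∑ q ∈ K,
      (χ i p x * χ j p x) * (χ k q x * χ l q x) := by
  rw [← sum_reorder, sq]
  simp only [coincidences, Finset.sum_mul]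
  simp only [Finset.mul_sum]

variable (hχ : ∀ i p, Measurable (χ i p)) (h0 : ∀ i p x, 0 ≤ χ i p x)
  (h1 : ∀ i p x, χ i p x ≤ 1) (hsum : ∀ i x, ∑ p ∈ K, χ i p x ≤ 1)
  (hP : ∀ i p, ∫ x, χ i p x ∂μ = P p) (hη : 0 ≤ η)
  (h2 : ∀ i k p q, i + g ≤ k ∨ k + g ≤ i → |∫ x, χ i p x * χ k q x ∂μ - P p * P q| ≤ η)
  (h4 : ∀ i ∈ A, ∀ k ∈ A, ∀ j ∈ B, ∀ l ∈ B, ∀ p q,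
    |∫ x, (χ i p x * χ j p x) * (χ k q x * χ l q x) ∂μ
      - (∫ x, χ i p x * χ k q x ∂μ) * ∫ x, χ j p x * χ l q x ∂μ| ≤ η)
  (hAB : ∀ i ∈ A, ∀ j ∈ B, i + g ≤ j) (hA : A.card = N) (hB : B.card = N)

include hχ h0 h1

lemma integrable_mul_mul (i j : ℕ) (p q : κ) : Integrable (fun x => χ i p x * χ j q x) μ :=
  integrable_of_mem_unitInterval ((hχ i p).mul (hχ j q)) (fun x => mul_nonneg (h0 i p x) (h0 j q x))
    fun x => mul_le_one₀ (h1 i p x) (h0 j q x) (h1 j q x)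

lemma integrable_four (i j k l : ℕ) (p q : κ) :
    Integrable (fun x => (χ i p x * χ j p x) * (χ k q x * χ l q x)) μ :=
  integrable_of_mem_unitInterval
    (((hχ i p).mul (hχ j p)).mul ((hχ k q).mul (hχ l q)))
    (fun x => mul_nonneg (mul_nonneg (h0 i p x) (h0 j p x)) (mul_nonneg (h0 k q x) (h0 l q x)))
    fun x => mul_le_one₀ (mul_le_one₀ (h1 i p x) (h0 j p x) (h1 j p x))
      (mul_nonneg (h0 k q x) (h0 l q x)) (mul_le_one₀ (h1 k q x) (h0 l q x) (h1 l q x))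

lemma integral_coincidences : ∫ x, coincidences χ K A B x ∂μ
    = ∑ i ∈ A, ∑ j ∈ B, ∑ p ∈ K, ∫ x, χ i p x * χ j p x ∂μ := by
  have hi := integrable_mul_mul (μ := μ) hχ h0 h1
  unfold coincidences
  rw [integral_finsetSum _ fun i _ => integrable_finsetSum _ fun j _ =>
    integrable_finsetSum _ fun p _ => hi i j p p]
  refine Finset.sum_congr rfl fun i _ => ?_
  rw [integral_finsetSum _ fun j _ => integrable_finsetSum _ fun p _ => hi i j p p]
  exact Finset.sum_congr rfl fun j _ => integral_finsetSum _ fun p _ => hi i j p p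

lemma integral_coincidences_sq : ∫ x, coincidences χ K A B x ^ 2 ∂μ
    = ∑ i ∈ A, ∑ k ∈ A, ∑ j ∈ B, ∑ l ∈ B, ∑ p ∈ K, ∑ q ∈ K,
      ∫ x, (χ i p x * χ j p x) * (χ k q x * χ l q x) ∂μ := by
  have hi := integrable_four (μ := μ) hχ h0 h1
  simp only [coincidences_sq]
  rw [integral_finsetSum _ fun i _ => integrable_finsetSum _ fun k _ =>
    integrable_finsetSum _ fun j _ => integrable_finsetSum _ fun l _ =>
    integrable_finsetSum _ fun p _ => integrable_finsetSum _ fun q _ => hi i j k l p q]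
  refine Finset.sum_congr rfl fun i _ => ?_
  rw [integral_finsetSum _ fun k _ =>
    integrable_finsetSum _ fun j _ => integrable_finsetSum _ fun l _ =>
    integrable_finsetSum _ fun p _ => integrable_finsetSum _ fun q _ => hi i j k l p q]
  refine Finset.sum_congr rfl fun k _ => ?_
  rw [integral_finsetSum _ fun j _ => integrable_finsetSum _ fun l _ =>
    integrable_finsetSum _ fun p _ => integrable_finsetSum _ fun q _ => hi i j k l p q]
  refine Finset.sum_congr rfl fun j _ => ?_
  rw [integral_finsetSum _ fun l _ =>
    integrable_finsetSum _ fun p _ => integrable_finsetSum _ fun q _ => hi i j k l p q]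
  refine Finset.sum_congr rfl fun l _ => ?_
  rw [integral_finsetSum _ fun p _ => integrable_finsetSum _ fun q _ => hi i j k l p q]
  exact Finset.sum_congr rfl fun p _ => integral_finsetSum _ fun q _ => hi i j k l p q

lemma integrable_coincidences : Integrable (coincidences χ K A B) μ :=
  integrable_finsetSum _ fun i _ => integrable_finsetSum _ fun j _ =>
    integrable_finsetSum _ fun p _ => integrable_mul_mul hχ h0 h1 i j p p

lemma integrable_coincidences_sq : Integrable (fun x => coincidences χ K A B x ^ 2) μ := by
  simp only [coincidences_sq]
  exact integrable_finsetSum _ fun i _ => integrable_finsetSum _ fun k _ =>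
    integrable_finsetSum _ fun j _ => integrable_finsetSum _ fun l _ =>
    integrable_finsetSum _ fun p _ => integrable_finsetSum _ fun q _ =>
    integrable_four hχ h0 h1 i j k l p q

include hP

lemma joint_le (i k : ℕ) (p q : κ) : ∫ x, χ i p x * χ k q x ∂μ ≤ P p := by
  rw [← hP i p]
  exact integral_mono (integrable_mul_mul hχ h0 h1 i k p q)
    (integrable_of_mem_unitInterval (hχ i p) (h0 i p) (h1 i p))
    fun x => mul_le_of_le_one_right (h0 i p x) (h1 k q x)

include hsum

lemma sum_joint_le (i k : ℕ) (p : κ) : ∑ q ∈ K, ∫ x, χ i p x * χ k q x ∂μ ≤ P p := by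
  rw [← integral_finsetSum _ fun q _ => integrable_mul_mul hχ h0 h1 i k p q, ← hP i p]
  refine integral_mono (integrable_finsetSum _ fun q _ => integrable_mul_mul hχ h0 h1 i k p q)
    (integrable_of_mem_unitInterval (hχ i p) (h0 i p) (h1 i p)) fun x => ?_
  simp only [← Finset.mul_sum]
  exact mul_le_of_le_one_right (h0 i p x) (hsum k x)

lemma sum_marginal_le_one : ∑ p ∈ K, P p ≤ 1 := by
  have hi : ∀ p ∈ K, Integrable (χ 0 p) μ := fun p _ =>
    integrable_of_mem_unitInterval (hχ 0 p) (h0 0 p) (h1 0 p)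
  simp only [← hP 0]
  rw [← integral_finsetSum _ hi]
  refine (integral_mono (integrable_finsetSum _ hi) (integrable_const 1) (hsum 0)).trans ?_
  simp

include hη h2 h4 hA hB

/-- Close pairs number at most 2gN in each block, which weights the cases of
`sum_mul_le_of_coupling`. Of the three errors `η`, one comes from splitting the four-fold
correlation and two from the pair correlations. -/
lemma integral_coincidences_sq_le :
    ∫ x, coincidences χ K A B x ^ 2 ∂μ ≤
      (N : ℝ) ^ 4 * ((∑ p ∈ K, P p ^ 2) ^ 2 + 3 * η * (K.card : ℝ) ^ 2)
      + 4 * g * N ^ 3 * ((∑ p ∈ K, P p ^ 2) * √(∑ p ∈ K, P p ^ 2))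
      + 4 * g ^ 2 * N ^ 2 * (∑ p ∈ K, P p ^ 2) := by
  set M := ∑ p ∈ K, P p ^ 2 with hMdef
  have hM : 0 ≤ M := Finset.sum_nonneg fun _ _ => sq_nonneg _
  set c : ℕ → ℕ → ℝ := fun i k => if i < k + g ∧ k < i + g then 1 else 0 with hc
  have hc0 : ∀ i k, 0 ≤ c i k := fun i k => by simp only [hc]; split_ifs <;> norm_num
  have hP1 : ∀ p, P p ≤ 1 := fun p => by
    rw [← hP 0 p]
    refine (integral_mono (integrable_of_mem_unitInterval (hχ 0 p) (h0 0 p) (h1 0 p))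
      (integrable_const 1) (h1 0 p)).trans ?_
    simp
  have hm0 : ∀ i k p q, 0 ≤ ∫ x, χ i p x * χ k q x ∂μ := fun i k p q =>
    integral_nonneg fun x => mul_nonneg (h0 i p x) (h0 k q x)
  have hcol : ∀ i k q, ∑ p ∈ K, ∫ x, χ i p x * χ k q x ∂μ ≤ P q := fun i k q => by
    simpa only [mul_comm] using sum_joint_le hχ h0 h1 hsum hP k i q
  have hfar : ∀ i k, ¬ (i < k + g ∧ k < i + g) → ∀ p q,
      ∫ x, χ i p x * χ k q x ∂μ ≤ P p * P q + η := fun i k hik p q => by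
    linarith [(abs_le.1 (h2 i k p q (by omega))).2]
  have hquad : ∀ i ∈ A, ∀ k ∈ A, ∀ j ∈ B, ∀ l ∈ B,
      ∑ p ∈ K, ∑ q ∈ K, ∫ x, (χ i p x * χ j p x) * (χ k q x * χ l q x) ∂μ
      ≤ M ^ 2 + c i k * (M * √M) + c j l * (M * √M) + c i k * c j l * M
        + 3 * η * (K.card : ℝ) ^ 2 := by
    intro i hi k hk j hj l hl
    have hs : ∑ p ∈ K, ∑ q ∈ K, ∫ x, (χ i p x * χ j p x) * (χ k q x * χ l q x) ∂μ
        ≤ ∑ p ∈ K, ∑ q ∈ K,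
          ((∫ x, χ i p x * χ k q x ∂μ) * (∫ x, χ j p x * χ l q x ∂μ) + η) :=
      Finset.sum_le_sum fun p _ => Finset.sum_le_sum fun q _ => by
        linarith [(abs_le.1 (h4 i hi k hk j hj l hl p q)).2]
    simp only [Finset.sum_add_distrib, Finset.sum_const, nsmul_eq_mul] at hs
    have := sum_mul_le_of_coupling (K := K) hη hP1 (hm0 i k) (joint_le hχ h0 h1 hP i k)
      (sum_joint_le hχ h0 h1 hsum hP i k) (hcol i k) (hm0 j l) (joint_le hχ h0 h1 hP j l)
      (sum_joint_le hχ h0 h1 hsum hP j l) (hcol j l) (hfar i k) (hfar j l)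
    simp only [hc]
    linarith
  rw [integral_coincidences_sq hχ h0 h1]
  refine (Finset.sum_le_sum fun i hi => Finset.sum_le_sum fun k hk => Finset.sum_le_sum fun j hj =>
    Finset.sum_le_sum fun l hl => hquad i hi k hk j hj l hl).trans ?_
  have hcA := sum_near_le A g
  have hcB := sum_near_le B g
  rw [hA] at hcA
  rw [hB] at hcB
  have hcA0 : 0 ≤ ∑ i ∈ A, ∑ k ∈ A, c i k :=
    Finset.sum_nonneg fun i _ => Finset.sum_nonneg fun k _ => hc0 i k
  have hcB0 : 0 ≤ ∑ i ∈ B, ∑ k ∈ B, c i k :=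
    Finset.sum_nonneg fun i _ => Finset.sum_nonneg fun k _ => hc0 i k
  have hexp : ∑ i ∈ A, ∑ k ∈ A, ∑ j ∈ B, ∑ l ∈ B,
      (M ^ 2 + c i k * (M * √M) + c j l * (M * √M) + c i k * c j l * M
        + 3 * η * (K.card : ℝ) ^ 2)
      = (N : ℝ) ^ 4 * (M ^ 2 + 3 * η * (K.card : ℝ) ^ 2)
        + (N : ℝ) ^ 2 * (∑ i ∈ A, ∑ k ∈ A, c i k) * (M * √M)
        + (N : ℝ) ^ 2 * (∑ j ∈ B, ∑ l ∈ B, c j l) * (M * √M)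
        + (∑ i ∈ A, ∑ k ∈ A, c i k) * (∑ j ∈ B, ∑ l ∈ B, c j l) * M := by
    simp only [Finset.sum_add_distrib, Finset.sum_const, nsmul_eq_mul, ← Finset.sum_mul,
      ← Finset.mul_sum, hA, hB]
    ring
  rw [hexp]
  have hMs : 0 ≤ M * √M := mul_nonneg hM (Real.sqrt_nonneg _)
  have t1 : (N : ℝ) ^ 2 * (∑ i ∈ A, ∑ k ∈ A, c i k) * (M * √M)
      ≤ (N : ℝ) ^ 2 * (2 * g * N) * (M * √M) := by gcongr
  have t2 : (N : ℝ) ^ 2 * (∑ i ∈ B, ∑ k ∈ B, c i k) * (M * √M)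
      ≤ (N : ℝ) ^ 2 * (2 * g * N) * (M * √M) := by gcongr
  have t3 : (∑ i ∈ A, ∑ k ∈ A, c i k) * (∑ j ∈ B, ∑ l ∈ B, c j l) * M
      ≤ (2 * g * N) * (2 * g * N) * M := by gcongr
  linarith

include hAB

/-- The second moment method: coincidences occur outside a set of small measure. -/
theorem measureReal_coincidences_eq_zero_le (hK : K.Nonempty) :
    μ.real {x | coincidences χ K A B x = 0} * ((N : ℝ) ^ 2 * ∑ p ∈ K, P p ^ 2) ^ 2
      ≤ 4 * g * N ^ 3 * ((∑ p ∈ K, P p ^ 2) * √(∑ p ∈ K, P p ^ 2))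
        + 4 * g ^ 2 * N ^ 2 * (∑ p ∈ K, P p ^ 2) + 5 * N ^ 4 * (K.card : ℝ) ^ 2 * η := by
  have hsq := integral_coincidences_sq_le hχ h0 h1 hsum hP hη h2 h4 hA hB
  set M := ∑ p ∈ K, P p ^ 2 with hMdef
  have hM : 0 ≤ M := Finset.sum_nonneg fun _ _ => sq_nonneg _
  have hP0 : ∀ p, 0 ≤ P p := fun p => by
    rw [← hP 0 p]; exact integral_nonneg (h0 0 p)
  have hM1 : M ≤ 1 := by
    have hs := sum_marginal_le_one hχ h0 h1 hsum hP
    refine le_trans (Finset.sum_le_sum fun p hp => ?_) hs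
    have : P p ≤ 1 := (Finset.single_le_sum (fun q _ => hP0 q) hp).trans hs
    nlinarith [hP0 p]
  have hk : (1 : ℝ) ≤ K.card := by exact_mod_cast hK.card_pos
  have hmean : (N : ℝ) ^ 2 * (M - K.card * η) ≤ ∫ x, coincidences χ K A B x ∂μ := by
    rw [integral_coincidences hχ h0 h1]
    have : ∑ i ∈ A, ∑ j ∈ B, ∑ p ∈ K, (P p ^ 2 - η)
        ≤ ∑ i ∈ A, ∑ j ∈ B, ∑ p ∈ K, ∫ x, χ i p x * χ j p x ∂μ :=
      Finset.sum_le_sum fun i hi => Finset.sum_le_sum fun j hj => Finset.sum_le_sum fun p _ => by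
        linarith [(abs_le.1 (h2 i j p p (Or.inl (hAB i hi j hj)))).1]
    refine le_trans (le_of_eq ?_) this
    simp only [Finset.sum_sub_distrib, Finset.sum_const, nsmul_eq_mul, hA, hB]
    ring
  -- Chebyshev is centred at this approximation of the expectation. The discrepancy costs two
  -- further errors `η`, which makes five in all.
  set mean := (N : ℝ) ^ 2 * M with hmeandef
  have hi1 := integrable_coincidences (K := K) (A := A) (B := B) (μ := μ) hχ h0 h1
  have hi2 := integrable_coincidences_sq (K := K) (A := A) (B := B) (μ := μ) hχ h0 h1
  have hexp : (fun x => (coincidences χ K A B x - mean) ^ 2)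
      = fun x => coincidences χ K A B x ^ 2 - 2 * mean * coincidences χ K A B x + mean ^ 2 := by
    ext x; ring
  have hi3 : Integrable (fun x => (coincidences χ K A B x - mean) ^ 2) μ := by
    rw [hexp]
    exact (hi2.sub (hi1.const_mul _)).add (integrable_const _)
  have hvar : ∫ x, (coincidences χ K A B x - mean) ^ 2 ∂μ
      = ∫ x, coincidences χ K A B x ^ 2 ∂μ - 2 * mean * ∫ x, coincidences χ K A B x ∂μ
        + mean ^ 2 := by
    have hi4 : Integrable (fun x => coincidences χ K A B x ^ 2
        - 2 * mean * coincidences χ K A B x) μ := hi2.sub (hi1.const_mul _)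
    rw [hexp, integral_add hi4 (integrable_const _), integral_sub hi2 (hi1.const_mul _), integral_const_mul]
    simp
  have hcheb := mul_meas_ge_le_integral_of_nonneg (μ := μ)
    (Eventually.of_forall fun x => sq_nonneg (coincidences χ K A B x - mean)) hi3 (mean ^ 2)
  have hsub : μ.real {x | coincidences χ K A B x = 0}
      ≤ μ.real {x | mean ^ 2 ≤ (coincidences χ K A B x - mean) ^ 2} :=
    measureReal_mono fun x (hx : _ = 0) => by
      change mean ^ 2 ≤ _
      rw [hx]; exact le_of_eq (by ring)
  have hmean0 : 0 ≤ mean := by positivity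
  have h5 : μ.real {x | coincidences χ K A B x = 0} * mean ^ 2
      ≤ ∫ x, (coincidences χ K A B x - mean) ^ 2 ∂μ := by
    refine le_trans ?_ hcheb
    rw [mul_comm]
    exact mul_le_mul_of_nonneg_left hsub (sq_nonneg _)
  have h6 : 2 * mean * ((N : ℝ) ^ 2 * (M - K.card * η))
      ≤ 2 * mean * ∫ x, coincidences χ K A B x ∂μ := by gcongr
  have h7 : (N : ℝ) ^ 4 * (M * K.card * η) ≤ N ^ 4 * (K.card * K.card * η) := by
    gcongr; linarith
  rw [hvar] at h5
  have e1 : 2 * mean * ((N : ℝ) ^ 2 * (M - K.card * η))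
      = 2 * mean ^ 2 - 2 * (N ^ 4 * (M * K.card * η)) := by rw [hmeandef]; ring
  have e2 : mean ^ 2 = (N : ℝ) ^ 4 * M ^ 2 := by rw [hmeandef]; ring
  linarith

end SecondMoment

end

/-! ### Four-fold mixing: the sets of full measure -/

section


variable {X : Set ℝ} {μ : Measure X} [IsProbabilityMeasure μ] {T : X → X}

lemma integral_comp_iterate {ν : Measure X} (hT : MeasurePreserving T ν ν) {f : X → ℝ}
    (hf : BddMeas f) (i : ℕ) : ∫ x, f (T^[i] x) ∂ν = ∫ x, f x ∂ν := by
  conv_rhs => rw [← (hT.iterate i).map_eq]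
  exact (integral_map (hT.iterate i).aemeasurable hf.1.aestronglyMeasurable).symm

section Correlations

variable {ι : Type*} {E : ι → Set X} {C θ : ℝ}
  (hT : MeasurePreserving T μ μ) (hE : ∀ i, MeasurableSet (E i)) (hC : 0 < C) (hθ : 0 < θ)
  (hmix : ∀ (i j k l : ι) (a b c : ℕ), a < b → b ≤ c →
      |defect T μ a b c (ind (E i)) (ind (E j)) (ind (E k)) (ind (E l))|
        ≤ C * Real.exp (-θ * ((b : ℝ) - a)))

include hT hE hC hθ hmix

lemma abs_four_sub_le_of_ordered {g : ℕ} (hg : 1 ≤ g) {i k j l : ℕ} (hik : i ≤ k) (hjl : j ≤ l)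
    (hkj : k + g ≤ j) (p q s t : ι) :
    |∫ x, (ind (E p) (T^[i] x) * ind (E q) (T^[k] x)) *
        (ind (E s) (T^[j] x) * ind (E t) (T^[l] x)) ∂μ
      - (∫ x, ind (E p) (T^[i] x) * ind (E q) (T^[k] x) ∂μ)
        * ∫ x, ind (E s) (T^[j] x) * ind (E t) (T^[l] x) ∂μ| ≤ C * Real.exp (-θ * g) := by
  have he : ∀ p, BddMeas (ind (E p)) := fun p => bddMeas_ind (hE p)
  have hi : ∀ n, Measurable T^[n] := fun n => hT.measurable.iterate n
  have h := hmix p q s t (k - i) (j - i) (l - i) (by omega) (by omega)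
  have e1 : ∫ x, (ind (E p) (T^[i] x) * ind (E q) (T^[k] x)) *
        (ind (E s) (T^[j] x) * ind (E t) (T^[l] x)) ∂μ
      = ∫ x, ind (E p) x * ind (E q) (T^[k - i] x) * ind (E s) (T^[j - i] x)
          * ind (E t) (T^[l - i] x) ∂μ := by
    rw [← integral_comp_iterate hT ((((he p).mul ((he q).comp (hi _))).mul ((he s).comp (hi _))).mul
      ((he t).comp (hi _))) i]
    refine integral_congr_ae (Eventually.of_forall fun x => ?_)
    simp only [← Function.iterate_add_apply, Nat.sub_add_cancel hik,
      Nat.sub_add_cancel (show i ≤ j by omega), Nat.sub_add_cancel (show i ≤ l by omega), mul_assoc]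
  have e2 : ∫ x, ind (E p) (T^[i] x) * ind (E q) (T^[k] x) ∂μ
      = ∫ x, ind (E p) x * ind (E q) (T^[k - i] x) ∂μ := by
    rw [← integral_comp_iterate hT ((he p).mul ((he q).comp (hi _))) i]
    simp only [← Function.iterate_add_apply, Nat.sub_add_cancel hik]
  have e3 : ∫ x, ind (E s) (T^[j] x) * ind (E t) (T^[l] x) ∂μ
      = ∫ x, ind (E s) x * ind (E t) (T^[l - i - (j - i)] x) ∂μ := by
    rw [← integral_comp_iterate hT ((he s).mul ((he t).comp (hi _))) j]
    simp only [← Function.iterate_add_apply, show l - i - (j - i) + j = l by omega]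
  rw [e1, e2, e3]
  refine h.trans ?_
  have hcast : (g : ℝ) ≤ ((j - i : ℕ) : ℝ) - ((k - i : ℕ) : ℝ) := by
    rw [le_sub_iff_add_le]
    exact_mod_cast (by omega : g + (k - i) ≤ j - i)
  refine mul_le_mul_of_nonneg_left (Real.exp_le_exp.2 ?_) hC.le
  nlinarith

lemma abs_four_sub_le {g : ℕ} (hg : 1 ≤ g) {i k j l : ℕ} (hij : i + g ≤ j) (hil : i + g ≤ l)
    (hkj : k + g ≤ j) (hkl : k + g ≤ l) (p q s t : ι) :
    |∫ x, (ind (E p) (T^[i] x) * ind (E q) (T^[k] x)) *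
        (ind (E s) (T^[j] x) * ind (E t) (T^[l] x)) ∂μ
      - (∫ x, ind (E p) (T^[i] x) * ind (E q) (T^[k] x) ∂μ)
        * ∫ x, ind (E s) (T^[j] x) * ind (E t) (T^[l] x) ∂μ| ≤ C * Real.exp (-θ * g) := by
  have key := fun {i k j l : ℕ} (hik : i ≤ k) (hjl : j ≤ l) (hkj : k + g ≤ j) =>
    abs_four_sub_le_of_ordered hT hE hC hθ hmix hg hik hjl hkj
  rcases le_total i k with h | h <;> rcases le_total j l with h' | h'
  · exact key h h' hkj p q s t
  · have := key h h' hkl p q t s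
    simpa only [mul_comm (ind (E t) _) (ind (E s) _)] using this
  · have := key h h' hij q p s t
    simpa only [mul_comm (ind (E q) _) (ind (E p) _)] using this
  · have := key h h' hil q p t s
    simpa only [mul_comm (ind (E t) _) (ind (E s) _), mul_comm (ind (E q) _) (ind (E p) _)]
      using this

/-- Two-fold mixing is four-fold mixing with the constant 1 in two slots; this is why the family of
sets contains the whole space. -/
lemma abs_two_sub_le {o : ι} (ho : E o = univ) {g : ℕ} (hg : 1 ≤ g) {i k : ℕ}
    (hik : i + g ≤ k ∨ k + g ≤ i) (p q : ι) :
    |∫ x, ind (E p) (T^[i] x) * ind (E q) (T^[k] x) ∂μ - μ.real (E p) * μ.real (E q)|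
      ≤ C * Real.exp (-θ * g) := by
  have hone : ∀ x, ind (E o) x = 1 := fun x => by rw [ho]; simp
  have hint : ∀ p j, ∫ x, ind (E p) (T^[j] x) ∂μ = μ.real (E p) := fun p j => by
    rw [integral_comp_iterate hT (bddMeas_ind (hE p)), integral_indicator_one (hE p)]
  have key : ∀ {i k : ℕ}, i + g ≤ k → ∀ p q,
      |∫ x, ind (E p) (T^[i] x) * ind (E q) (T^[k] x) ∂μ - μ.real (E p) * μ.real (E q)|
      ≤ C * Real.exp (-θ * g) := fun {i k} h p q => by
    have := abs_four_sub_le hT hE hC hθ hmix hg h h h h p o q o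
    simpa only [hone, mul_one, hint] using this
  rcases hik with h | h
  · exact key h p q
  · have := key h q p
    simpa only [mul_comm (ind (E q) _) (ind (E p) _), mul_comm (μ.real (E q))] using this

end Correlations

/-- The four-fold mixing error has no summable factor, so the number of cells must be bounded. The
squares sum to at least b/3, a finite set captures more than b/6, and its cells of measure below
b/12 account for at most b/12. The remaining ones number at most 12/b. -/
lemma exists_heavy_cells {r δ : ℝ} (hr : 0 < r) (hδ : r ≤ δ) :
    ∃ K : Finset ℤ, K.Nonempty ∧ ballIntegral μ r ≤ 12 * ∑ k ∈ K, μ.real (cell X δ k) ^ 2 ∧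
      (K.card : ℝ) * ballIntegral μ r ≤ 12 := by
  classical
  set b := ballIntegral μ r
  have hb : 0 < b := ballIntegral_pos hr
  have hsum := (hasSum_measureReal_cell (μ := μ) δ)
  obtain ⟨s, hs⟩ : ∃ s : Finset ℤ, b / 6 < ∑ k ∈ s, μ.real (cell X δ k) ^ 2 := by
    refine ((summable_sq_cell (μ := μ) δ).hasSum.eventually (lt_mem_nhds ?_)).exists
    have := ballIntegral_le (μ := μ) (hr.trans_le hδ) hδ
    linarith
  have hs1 : ∑ k ∈ s, μ.real (cell X δ k) ≤ 1 :=
    sum_le_hasSum s (fun _ _ => measureReal_nonneg) hsum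
  have hsplit := Finset.sum_filter_add_sum_filter_not s
    (fun k => b / 12 ≤ μ.real (cell X δ k)) (fun k => μ.real (cell X δ k) ^ 2)
  have hlight : ∑ k ∈ s.filter (fun k => ¬ b / 12 ≤ μ.real (cell X δ k)),
      μ.real (cell X δ k) ^ 2 ≤ b / 12 := by
    calc _ ≤ ∑ k ∈ s.filter (fun k => ¬ b / 12 ≤ μ.real (cell X δ k)),
          b / 12 * μ.real (cell X δ k) := by
          refine Finset.sum_le_sum fun k hk => ?_
          rw [sq]
          exact mul_le_mul_of_nonneg_right (not_le.1 (Finset.mem_filter.1 hk).2).le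
            measureReal_nonneg
      _ ≤ ∑ k ∈ s, b / 12 * μ.real (cell X δ k) :=
          Finset.sum_le_sum_of_subset_of_nonneg (Finset.filter_subset _ _)
            fun _ _ _ => mul_nonneg (by positivity) measureReal_nonneg
      _ ≤ _ := by
          rw [← Finset.mul_sum]
          exact mul_le_of_le_one_right (by positivity) hs1
  refine ⟨s.filter fun k => b / 12 ≤ μ.real (cell X δ k), ?_, by linarith, ?_⟩
  · by_contra h
    rw [Finset.not_nonempty_iff_eq_empty] at h
    rw [h, Finset.sum_empty] at hsplit
    linarith
  · have h1 : ((s.filter fun k => b / 12 ≤ μ.real (cell X δ k)).card : ℝ) * (b / 12)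
        ≤ ∑ k ∈ s.filter (fun k => b / 12 ≤ μ.real (cell X δ k)), μ.real (cell X δ k) := by
      rw [← nsmul_eq_mul]
      exact Finset.card_nsmul_le_sum _ _ _ fun k hk => (Finset.mem_filter.1 hk).2
    have h2 : ∑ k ∈ s.filter (fun k => b / 12 ≤ μ.real (cell X δ k)), μ.real (cell X δ k)
        ≤ ∑ k ∈ s, μ.real (cell X δ k) :=
      Finset.sum_le_sum_of_subset_of_nonneg (Finset.filter_subset _ _)
        fun _ _ _ => measureReal_nonneg
    linarith

lemma sum_ind_cell_le_one (δ : ℝ) (K : Finset ℤ) (x : X) :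
    ∑ k ∈ K, ind (cell X δ k) x ≤ 1 := by
  classical
  have : ∀ k, ind (cell X δ k) x = if ⌊(x : ℝ) / δ⌋ = k then 1 else 0 := fun k => by
    simp [indicator, cell]
  simp only [this, Finset.sum_ite_eq]
  split_ifs <;> norm_num

lemma compl_F_subset_coincidences_eq_zero {δ r : ℝ} (hδ : 0 < δ) (hr : δ ≤ r) {n : ℕ}
    {A B : Finset ℕ} (hAB : ∀ i ∈ A, ∀ j ∈ B, i < j) (hB : ∀ j ∈ B, j < n) (K : Finset ℤ) :
    (F T n r)ᶜ ⊆ {x | coincidences (fun i k x => ind (cell X δ k) (T^[i] x)) K A B x = 0} := by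
  intro x hx
  refine Finset.sum_eq_zero fun i hi => Finset.sum_eq_zero fun j hj =>
    Finset.sum_eq_zero fun k _ => ?_
  by_contra h
  refine hx ⟨i, j, hAB i hi j hj, hB j hj, ?_⟩
  rw [mul_eq_zero, not_or] at h
  exact (dist_lt_of_mem_cell hδ (mem_of_indicator_ne_zero h.1)
    (mem_of_indicator_ne_zero h.2)).trans_le hr

lemma le_of_second_moment {ν N g M k η : ℝ} (hN : 0 < N) (hM : 0 < M)
    (h : ν * (N ^ 2 * M) ^ 2 ≤ 4 * g * N ^ 3 * (M * √M) + 4 * g ^ 2 * N ^ 2 * M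
      + 5 * N ^ 4 * k ^ 2 * η) :
    ν ≤ 4 * (g / (N * √M)) + 4 * (g / (N * √M)) ^ 2 + 5 * (k / M) ^ 2 * η := by
  obtain ⟨s, hs, rfl⟩ : ∃ s, 0 < s ∧ M = s ^ 2 :=
    ⟨√M, Real.sqrt_pos.2 hM, (Real.sq_sqrt hM.le).symm⟩
  rw [Real.sqrt_sq hs.le] at h ⊢
  have h' : ν ≤ (4 * g * N ^ 3 * (s ^ 2 * s) + 4 * g ^ 2 * N ^ 2 * s ^ 2
      + 5 * N ^ 4 * k ^ 2 * η) / (N ^ 2 * s ^ 2) ^ 2 := (le_div_iff₀ (by positivity)).2 h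
  refine h'.trans (le_of_eq ?_)
  field_simp

/-- The grid cells of dyadic mesh, together with the whole space. -/
def dyadicCell (X : Set ℝ) : Option (ℤ × ℤ) → Set X
  | none => univ
  | some (m, k) => cell X ((2 : ℝ) ^ m) k

lemma measurableSet_dyadicCell (i : Option (ℤ × ℤ)) : MeasurableSet (dyadicCell X i) := by
  rcases i with _ | ⟨m, k⟩
  · exact MeasurableSet.univ
  · exact measurableSet_cell _ _

lemma eVariationOn_ind_dyadicCell_le (i : Option (ℤ × ℤ)) :
    eVariationOn (ind (dyadicCell X i)) univ ≤ 2 := by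
  rcases i with _ | ⟨m, k⟩
  · have : eVariationOn (ind (dyadicCell X none)) univ = 0 :=
      eVariationOn.constant_on (by
        rintro _ ⟨x, _, rfl⟩ _ ⟨y, _, rfl⟩
        simp [dyadicCell])
    rw [this]; exact zero_le
  · exact eVariationOn_ind_cell_le (by positivity) _

section Estimate

variable {C θ : ℝ} (hT : MeasurePreserving T μ μ) (hC : 0 < C) (hθ : 0 < θ)
  (hdef : ∀ (i j k l : Option (ℤ × ℤ)) (a b c : ℕ), a < b → b ≤ c →
      |defect T μ a b c (ind (dyadicCell X i)) (ind (dyadicCell X j)) (ind (dyadicCell X k))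
          (ind (dyadicCell X l))| ≤ C * Real.exp (-θ * ((b : ℝ) - a)))

include hT hC hθ hdef

/-- The unused middle third of the times separates the two blocks by more than N ≥ g steps, as
four-fold mixing requires. -/
lemma coincidences_dyadic_le {g N : ℕ} (hg : 1 ≤ g) (hgN : g ≤ N) (m : ℤ) {K : Finset ℤ}
    (hK : K.Nonempty) :
    μ.real {x | coincidences (fun i k x => ind (cell X ((2 : ℝ) ^ m) k) (T^[i] x)) K
        (Finset.range N) (Finset.Ico (2 * N) (3 * N)) x = 0}
        * ((N : ℝ) ^ 2 * ∑ k ∈ K, μ.real (cell X ((2 : ℝ) ^ m) k) ^ 2) ^ 2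
      ≤ 4 * g * N ^ 3 * ((∑ k ∈ K, μ.real (cell X ((2 : ℝ) ^ m) k) ^ 2)
          * √(∑ k ∈ K, μ.real (cell X ((2 : ℝ) ^ m) k) ^ 2))
        + 4 * g ^ 2 * N ^ 2 * (∑ k ∈ K, μ.real (cell X ((2 : ℝ) ^ m) k) ^ 2)
        + 5 * N ^ 4 * (K.card : ℝ) ^ 2 * (C * Real.exp (-θ * g)) := by
  have hcell : ∀ k, MeasurableSet (cell X ((2 : ℝ) ^ m) k) := measurableSet_cell _
  have h2 : ∀ (i k : ℕ) (p q : ℤ), i + g ≤ k ∨ k + g ≤ i →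
      |∫ x, ind (cell X ((2 : ℝ) ^ m) p) (T^[i] x) * ind (cell X ((2 : ℝ) ^ m) q) (T^[k] x) ∂μ
        - μ.real (cell X ((2 : ℝ) ^ m) p) * μ.real (cell X ((2 : ℝ) ^ m) q)|
      ≤ C * Real.exp (-θ * g) := fun i k p q hik =>
    abs_two_sub_le hT measurableSet_dyadicCell hC hθ hdef (o := none) rfl hg hik
      (some (m, p)) (some (m, q))
  have h4 : ∀ i ∈ Finset.range N, ∀ k ∈ Finset.range N, ∀ j ∈ Finset.Ico (2 * N) (3 * N),
      ∀ l ∈ Finset.Ico (2 * N) (3 * N), ∀ p q : ℤ,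
      |∫ x, (ind (cell X ((2 : ℝ) ^ m) p) (T^[i] x) * ind (cell X ((2 : ℝ) ^ m) p) (T^[j] x))
          * (ind (cell X ((2 : ℝ) ^ m) q) (T^[k] x) * ind (cell X ((2 : ℝ) ^ m) q) (T^[l] x)) ∂μ
        - (∫ x, ind (cell X ((2 : ℝ) ^ m) p) (T^[i] x)
            * ind (cell X ((2 : ℝ) ^ m) q) (T^[k] x) ∂μ)
          * ∫ x, ind (cell X ((2 : ℝ) ^ m) p) (T^[j] x)
            * ind (cell X ((2 : ℝ) ^ m) q) (T^[l] x) ∂μ|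
      ≤ C * Real.exp (-θ * g) := by
    intro i hi k hk j hj l hl p q
    rw [Finset.mem_range] at hi hk
    rw [Finset.mem_Ico] at hj hl
    have := abs_four_sub_le hT measurableSet_dyadicCell hC hθ hdef hg (i := i) (k := k) (j := j)
      (l := l) (by omega) (by omega) (by omega) (by omega) (some (m, p)) (some (m, q))
      (some (m, p)) (some (m, q))
    rwa [integral_congr_ae (Eventually.of_forall fun x => mul_mul_mul_comm _ _ _ _)] at this
  exact measureReal_coincidences_eq_zero_le (P := fun k => μ.real (cell X ((2 : ℝ) ^ m) k))
    (fun i k => (measurable_ind (hcell k)).comp (hT.measurable.iterate i))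
    (fun i k x => ind_nonneg _ _) (fun i k x => ind_le_one _ _)
    (fun i x => sum_ind_cell_le_one _ K _)
    (fun i k => by
      rw [integral_comp_iterate hT (bddMeas_ind (hcell k)), integral_indicator_one (hcell k)])
    (by positivity) h2 h4
    (fun i hi j hj => by
      rw [Finset.mem_range] at hi
      rw [Finset.mem_Ico] at hj
      omega)
    (Finset.card_range N) (by rw [Nat.card_Ico]; omega) hK

lemma exists_compl_F_le {n g : ℕ} (hg : 1 ≤ g) (hgn : g ≤ n / 3) {r : ℝ} (hr : 0 < r) :
    ∃ k M : ℝ, 0 ≤ k ∧ 0 < M ∧ ballIntegral μ r ≤ 12 * M ∧ k * ballIntegral μ r ≤ 12 ∧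
      μ.real (F T n (4 * r))ᶜ ≤ 4 * (g / ((n / 3 : ℕ) * √M)) + 4 * (g / ((n / 3 : ℕ) * √M)) ^ 2
        + 5 * (k / M) ^ 2 * (C * Real.exp (-θ * g)) := by
  -- The mesh is the power of two in [r, 2r), so that only countably many cells ever occur.
  obtain ⟨m, hm⟩ := exists_mem_Ioc_zpow hr (one_lt_two (α := ℝ))
  have hδ : (2 : ℝ) ^ (m + 1) ≤ 4 * r := by
    rw [zpow_add_one₀ two_ne_zero]; linarith [hm.1]
  obtain ⟨K, hKne, hKM, hKcard⟩ := exists_heavy_cells (μ := μ) hr hm.2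
  have hM0 : 0 < ∑ k ∈ K, μ.real (cell X ((2 : ℝ) ^ (m + 1)) k) ^ 2 := by
    linarith [ballIntegral_pos (μ := μ) hr]
  refine ⟨K.card, _, Nat.cast_nonneg _, hM0, hKM, hKcard, ?_⟩
  have hsub := compl_F_subset_coincidences_eq_zero (T := T) (by positivity) hδ (n := n)
    (A := Finset.range (n / 3)) (B := Finset.Ico (2 * (n / 3)) (3 * (n / 3)))
    (fun i hi j hj => by rw [Finset.mem_range] at hi; rw [Finset.mem_Ico] at hj; omega)
    (fun j hj => by rw [Finset.mem_Ico] at hj; omega) K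
  exact (measureReal_mono hsub (measure_ne_top _ _)).trans
    (le_of_second_moment (by exact_mod_cast (by omega : 0 < n / 3)) hM0
      (coincidences_dyadic_le hT hC hθ hdef hg hgn (m + 1) hKne))

end Estimate

lemma exp_neg_mul_ceil_le {θ : ℝ} (hθ : 0 < θ) {n : ℕ} (hn : 0 < n) :
    Real.exp (-θ * ⌈9 / θ * Real.log n⌉₊) ≤ (1 / (n : ℝ)) ^ 9 := by
  have h1 : (1 / (n : ℝ)) ^ 9 = Real.exp (-(9 * Real.log n)) := by
    rw [Real.exp_neg, mul_comm, Real.exp_mul, Real.exp_log (by positivity)]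
    norm_num
  rw [h1]
  refine Real.exp_le_exp.2 ?_
  have h4 : 9 * Real.log n = θ * (9 / θ * Real.log n) := by field_simp
  have h5 := Nat.le_ceil (9 / θ * Real.log n)
  rw [h4]
  nlinarith

/-- Under four-fold mixing the orbit up to time `n` has two points within `4r`, outside a set of
measure `O(log n / (n √b))`, where `b` is the averaged measure of balls of radius `r`. -/
theorem measureReal_compl_F_le (hT : MeasurePreserving T μ μ) (hmix : Exp4Mixing T μ) :
    ∃ D > (0 : ℝ), ∀ (n : ℕ) (r : ℝ), 2 ≤ n → 0 < r → 1 / (n : ℝ) ^ 2 ≤ ballIntegral μ r →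
      μ.real (F T n (4 * r))ᶜ ≤ D * (Real.log n / (n * √(ballIntegral μ r))) := by
  obtain ⟨C, hC, θ, hθ, hdef⟩ := exists_uniform_mixing_bound measurableSet_dyadicCell
    eVariationOn_ind_dyadicCell_le hT.measurable hmix
  set K₁ : ℝ := 9 / θ + 2 with hK₁
  have hK₁0 : 0 < K₁ := by positivity
  -- With y = g/(N√M) ≤ 20 K₁ρ, the terms 4y and 4y² contribute 8 and 16 times 10 K₁ρ, and 207360 =
  -- 2 · 5 · 144².
  refine ⟨24 * (10 * K₁) + 207360 * C, by positivity, fun n r hn hr hb => ?_⟩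
  set b := ballIntegral μ r with hbdef
  have hb0 : 0 < b := ballIntegral_pos hr
  have hb1 : b ≤ 1 := ballIntegral_le_one r
  have hsb : 0 < √b := Real.sqrt_pos.2 hb0
  have hsb1 : √b ≤ 1 := Real.sqrt_le_one.2 hb1
  have hn0 : (0 : ℝ) < n := by positivity
  have hlog : 1 / 2 ≤ Real.log n := by
    have : Real.log 2 ≤ Real.log n := Real.log_le_log two_pos (by exact_mod_cast hn)
    linarith [Real.log_two_gt_d9]
  set ρ := Real.log n / (n * √b) with hρ
  have hρ0 : 0 < ρ := by positivity
  -- In the first case the claimed bound exceeds 1. In the second, n is large enough compared with g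
  -- for the two blocks to fit.
  rcases le_or_gt 1 (10 * K₁ * ρ) with hbig | hsmall
  · refine measureReal_le_one.trans (hbig.trans ?_)
    nlinarith [mul_pos hK₁0 hρ0, mul_pos hC hρ0]
  set g := ⌈9 / θ * Real.log n⌉₊ with hg
  have hg1 : 1 ≤ g := Nat.one_le_ceil_iff.2 (by positivity)
  have hgle : (g : ℝ) ≤ K₁ * Real.log n := by
    have := (Nat.ceil_lt_add_one (show 0 ≤ 9 / θ * Real.log n by positivity)).le
    rw [hK₁]
    linarith
  have hsmall' : 10 * K₁ * Real.log n < n * √b := by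
    rw [hρ, ← mul_div_assoc, div_lt_one (by positivity)] at hsmall
    exact hsmall
  have hgn : 10 * g < n := by
    have : (10 * g : ℝ) < n := by
      have := mul_le_of_le_one_right hn0.le hsb1
      linarith
    exact_mod_cast this
  obtain ⟨k, M, hk, hM0, hKM, hKcard, hle⟩ :=
    exists_compl_F_le hT hC hθ hdef hg1 (show g ≤ n / 3 by omega) hr
  refine hle.trans ?_
  have hnN : n ≤ 5 * (n / 3) := by omega
  have hN0 : (0 : ℝ) < (n / 3 : ℕ) := by exact_mod_cast (by omega : 0 < n / 3)
  have hexp := exp_neg_mul_ceil_le hθ (show 0 < n by omega)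
  generalize n / 3 = N at *
  have hy : (g : ℝ) / (N * √M) ≤ 2 * (10 * K₁ * ρ) := by
    have hsM : √b ≤ 4 * √M := by
      rw [Real.sqrt_le_left (by positivity), mul_pow, Real.sq_sqrt hM0.le]
      linarith
    have h5 : (n : ℝ) ≤ 5 * N := by exact_mod_cast hnN
    rw [div_le_iff₀ (by positivity)]
    calc (g : ℝ) ≤ K₁ * Real.log n := hgle
      _ = K₁ * ρ * (n * √b) := by rw [hρ]; field_simp
      _ ≤ K₁ * ρ * ((5 * N) * (4 * √M)) := by gcongr
      _ = _ := by ring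
  have hy0 : 0 ≤ (g : ℝ) / (N * √M) := by positivity
  -- Since b ≥ n⁻², (k/M)² is at most a multiple of n⁸. The constant 9 in `g` gives a mixing error
  -- of order n⁻⁹, leaving 1/n ≤ 2ρ.
  have herr : 5 * (k / M) ^ 2 * (C * Real.exp (-θ * g)) ≤ 207360 * C * ρ := by
    have h1 : k / M ≤ 144 / b ^ 2 := by
      rw [div_le_div_iff₀ hM0 (by positivity)]
      calc k * b ^ 2 = k * b * b := by ring
        _ ≤ 12 * (12 * M) := by gcongr
        _ = _ := by ring
    have h2 : 144 / b ^ 2 ≤ 144 * (n : ℝ) ^ 4 := by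
      rw [div_le_iff₀ (by positivity)]
      rw [div_le_iff₀ (by positivity)] at hb
      have := mul_le_mul hb hb zero_le_one (by positivity)
      linarith
    have h4 : 1 / (n : ℝ) ≤ 2 * ρ := by
      rw [hρ, ← mul_div_assoc, div_le_div_iff₀ hn0 (by positivity)]
      nlinarith [mul_le_mul_of_nonneg_left hsb1 hn0.le, mul_le_mul_of_nonneg_right hlog hn0.le]
    calc 5 * (k / M) ^ 2 * (C * Real.exp (-θ * g))
        ≤ 5 * (144 * (n : ℝ) ^ 4) ^ 2 * (C * (1 / n) ^ 9) := by
          gcongr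
          exact h1.trans h2
      _ = 103680 * C * (1 / n) := by field_simp; norm_num
      _ ≤ 103680 * C * (2 * ρ) := by gcongr
      _ = _ := by ring
  have hy2 : ((g : ℝ) / (N * √M)) ^ 2 ≤ 4 * (10 * K₁ * ρ) := by
    have h0 : 0 < 10 * K₁ * ρ := by positivity
    calc _ ≤ (2 * (10 * K₁ * ρ)) ^ 2 := by gcongr
      _ ≤ _ := by nlinarith
  linarith

lemma measure_eq_one_of_compl {s : Set X} (h : μ sᶜ = 0) : μ s = 1 := by
  have : s =ᵐ[μ] univ := by
    rw [ae_eq_univ]; exact h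
  rw [measure_congr this, measure_univ]

theorem measure_limsup_F_eq_one (hT : MeasurePreserving T μ μ) (hmix : Exp4Mixing T μ)
    {r h : ℕ → ℝ} (hr : ∀ n, 1 ≤ n → 0 < r n) (hh : Tendsto h atTop atTop)
    (hb : ∀ᶠ n : ℕ in atTop, Real.log n ^ 2 * h n / (n : ℝ) ^ 2 ≤ ballIntegral μ (r n)) :
    μ (limsup (fun n => F T n (4 * r n)) atTop) = 1 := by
  obtain ⟨D, hD, hF⟩ := measureReal_compl_F_le hT hmix
  refine measure_eq_one_of_compl ?_
  rw [limsup_compl]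
  refine measure_liminf_eq_zero (a := fun n => D * h n ^ (-(1 / 2) : ℝ)) ?_ ?_
  · filter_upwards [hb, hh.eventually_ge_atTop 4, eventually_ge_atTop 2] with n h1 h2 h3
    have hn0 : (0 : ℝ) < n := by positivity
    have hlog : 1 / 2 ≤ Real.log n := by
      have : Real.log 2 ≤ Real.log n := Real.log_le_log two_pos (by exact_mod_cast h3)
      linarith [Real.log_two_gt_d9]
    have hh0 : 0 < h n := by linarith
    refine (hF n (r n) h3 (hr n (by omega)) (le_trans ?_ h1)).trans ?_
    · gcongr
      nlinarith [mul_le_mul hlog hlog (by norm_num) (by linarith)]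
    · gcongr
      have hs : Real.log n * √(h n) / n ≤ √(ballIntegral μ (r n)) := by
        refine Real.le_sqrt_of_sq_le (le_trans (le_of_eq ?_) h1)
        rw [div_pow, mul_pow, Real.sq_sqrt hh0.le]
      have hs0 : 0 < Real.log n * √(h n) / n := by positivity
      rw [Real.rpow_neg hh0.le, ← Real.sqrt_eq_rpow]
      calc Real.log n / (n * √(ballIntegral μ (r n)))
          ≤ Real.log n / (n * (Real.log n * √(h n) / n)) := by gcongr
        _ = _ := by field_simp
  · have := ((tendsto_rpow_neg_atTop (show (0 : ℝ) < 1 / 2 by norm_num)).comp hh).const_mul D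
    simpa using this

lemma summable_inv_mul_log_rpow {p : ℝ} (hp : 1 < p) :
    Summable fun n : ℕ => ((n : ℝ) * Real.log n ^ p)⁻¹ := by
  rw [← summable_condensed_iff_of_eventually_nonneg]
  · have : (fun k : ℕ => (2 : ℝ) ^ k * (((2 ^ k : ℕ) : ℝ) * Real.log (2 ^ k : ℕ) ^ p)⁻¹)
        = fun k : ℕ => (Real.log 2 ^ p)⁻¹ * ((k : ℝ) ^ p)⁻¹ := by
      ext k
      push_cast
      rw [Real.log_pow, Real.mul_rpow (Nat.cast_nonneg k) (Real.log_nonneg one_le_two)]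
      field_simp
    rw [this]
    exact (Real.summable_nat_rpow_inv.2 hp).mul_left _
  · exact Eventually.of_forall fun n => by
      have := Real.log_natCast_nonneg n
      simp only [Pi.zero_apply]
      positivity
  -- The terms at 0 and 1 are 0 by the convention for inverses, so monotonicity starts at 2.
  · filter_upwards [eventually_ge_atTop 2] with n hn
    have h2 : (2 : ℝ) ≤ n := by exact_mod_cast hn
    have hlog : 0 < Real.log n := Real.log_pos (by linarith)
    push_cast
    gcongr <;> linarith

theorem measure_liminf_F_eq_one (hT : MeasurePreserving T μ μ) (hmix : Exp4Mixing T μ)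
    {r : ℕ → ℝ} (hr : ∀ n, 1 ≤ n → 0 < r n) {ε : ℝ} (hε : 0 < ε) (hanti : AntitoneOn r (Ici 1))
    (hb : ∀ᶠ n : ℕ in atTop,
        Real.log n ^ 4 * Real.log (Real.log n) ^ (2 + ε) / (n : ℝ) ^ 2 ≤ ballIntegral μ (r n)) :
    μ (liminf (fun n => F T n (4 * r n)) atTop) = 1 := by
  obtain ⟨D, hD, hF⟩ := measureReal_compl_F_le hT hmix
  refine measure_eq_one_of_compl ?_
  -- For 2^k ≤ n ≤ 2^(k+1), the shorter orbit and the smaller radius of the block give a subset of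
  -- F_{n,4r_n}; this uses that the radii decrease.
  have hsub : (liminf (fun n => F T n (4 * r n)) atTop)ᶜ
      ⊆ limsup (fun k => (F T (2 ^ k) (4 * r (2 ^ (k + 1))))ᶜ) atTop := by
    rw [liminf_compl]
    intro x hx
    rw [mem_limsup_iff_frequently_mem] at hx ⊢
    refine tendsto_natLog_atTop.frequently (hx.and_eventually (eventually_ge_atTop 1) |>.mono ?_)
    rintro n ⟨hxn, hn⟩
    have h := two_pow_natLog_le_and_le hn
    refine fun hF => hxn (F_mono T h.1 ?_ hF)
    linarith [hanti hn Nat.one_le_two_pow h.2]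
  refine measure_mono_null hsub ?_
  -- Half the exponent 2 + ε, because the bound involves √b. With L = log 2^(k+1), the k-th term is
  -- of order 1/(L (log L)^p), which is summable.
  set p : ℝ := 1 + ε / 2 with hp
  have hsum := ((summable_nat_add_iff 1).2
    (summable_inv_mul_log_rpow (show 1 < p by rw [hp]; linarith))).mul_left (D * (4 * 2 ^ p))
  refine measure_limsup_eq_zero_of_summable ?_ hsum
  filter_upwards [(tendsto_add_atTop_nat 1).eventually (tendsto_two_pow_atTop.eventually hb),
    eventually_ge_atTop 5] with k hk hk5
  push_cast at hk ⊢
  have hk5' : (5 : ℝ) ≤ k := by exact_mod_cast hk5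
  rw [Real.log_pow] at hk
  push_cast at hk
  set b := ballIntegral μ (r (2 ^ (k + 1)))
  have hl2 := Real.log_two_gt_d9
  set L := ((k : ℝ) + 1) * Real.log 2 with hL
  have hlk : 1 < Real.log ((k : ℝ) + 1) := by
    rw [Real.lt_log_iff_exp_lt (by linarith)]
    linarith [Real.exp_one_lt_d9]
  have hL1 : ((k : ℝ) + 1) / 2 ≤ L := by rw [hL]; nlinarith
  have hL2 : 1 / 2 * Real.log ((k : ℝ) + 1) ≤ Real.log L := by
    have h1 : √((k : ℝ) + 1) ≤ L := by
      rw [Real.sqrt_le_left (by linarith)]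
      nlinarith
    have h2 : Real.log √((k : ℝ) + 1) ≤ Real.log L :=
      Real.log_le_log (Real.sqrt_pos.2 (by linarith)) h1
    rw [Real.log_sqrt (by linarith)] at h2
    linarith
  have hll : 0 < Real.log L := by linarith
  have hL0 : 3 ≤ L := by linarith
  have hsq : Real.log L ^ (2 + ε) = (Real.log L ^ p) ^ 2 := by
    rw [← Real.rpow_natCast, ← Real.rpow_mul hll.le]
    congr 1; rw [hp]; push_cast; ring
  have hlp : (1 / 2 * Real.log ((k : ℝ) + 1)) ^ p ≤ Real.log L ^ p := by gcongr
  have hsb : L ^ 2 * Real.log L ^ p / 2 ^ (k + 1) ≤ √b := by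
    refine Real.le_sqrt_of_sq_le (le_trans (le_of_eq ?_) hk)
    rw [hsq]; ring
  have hb1 : 1 / ((2 ^ k : ℕ) : ℝ) ^ 2 ≤ b := by
    refine le_trans ?_ hk
    have hll1 : 1 ≤ Real.log L := by
      rw [Real.le_log_iff_exp_le (by linarith)]
      linarith [Real.exp_one_lt_d9]
    have h1 : 1 ≤ Real.log L ^ (2 + ε) := Real.one_le_rpow hll1 (by linarith)
    have h2 : (4 : ℝ) ≤ L ^ 4 := by
      calc (4 : ℝ) ≤ 3 ^ 4 := by norm_num
        _ ≤ L ^ 4 := by gcongr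
    push_cast
    rw [div_le_div_iff₀ (by positivity) (by positivity), pow_succ (2 : ℝ) k, mul_pow]
    nlinarith [mul_le_mul h2 h1 zero_le_one (by positivity), sq_nonneg ((2 : ℝ) ^ k)]
  refine (hF (2 ^ k) (r (2 ^ (k + 1))) (by
    calc 2 = 2 ^ 1 := rfl
      _ ≤ 2 ^ k := Nat.pow_le_pow_right (by norm_num) (by omega)) (hr _ Nat.one_le_two_pow)
      hb1).trans ?_
  rw [mul_assoc D]
  refine mul_le_mul_of_nonneg_left ?_ hD.le
  push_cast
  rw [Real.log_pow]
  have hkL : (k : ℝ) * Real.log 2 ≤ L := by rw [hL]; nlinarith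
  have hlp0 : 0 < Real.log L ^ p := by positivity
  calc (k : ℝ) * Real.log 2 / (2 ^ k * √b)
      ≤ L / (2 ^ k * (L ^ 2 * Real.log L ^ p / 2 ^ (k + 1))) := by gcongr
    _ = 2 * (L * Real.log L ^ p)⁻¹ := by field_simp; ring
    _ ≤ 2 * (((k : ℝ) + 1) / 2 * (1 / 2 * Real.log ((k : ℝ) + 1)) ^ p)⁻¹ := by gcongr
    _ = _ := by
      rw [Real.mul_rpow (by norm_num) (by linarith), one_div, Real.inv_rpow (by norm_num)]
      field_simp
      norm_num

end

end SingleOrbit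

end

theorem mainTheorem7 (X : Set ℝ) (hX : X.OrdConnected) (μ : Measure X) [IsProbabilityMeasure μ]
    (T : X → X) (hT : MeasurePreserving T μ μ) (r : ℕ → ℝ) (hr : ∀ n, 1 ≤ n → 0 < r n) :
    -- the liminf set is null
    (∀ C s : ℝ, 0 < C → 0 < s → SingleOrbit.ExpMixingBVL1 T μ →
      SingleOrbit.ShortReturnEstimate T μ C s →
      ∀ h : ℕ → ℝ, Tendsto h atTop atTop →
      (∀ᶠ n : ℕ in atTop, r n ≤ 1 / (((n : ℝ) * Real.log n) ^ (1 / s) * h n)) →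
      (∀ᶠ n : ℕ in atTop, SingleOrbit.ballIntegral μ (r n) ≤ 1 / ((n : ℝ) ^ 2 * h n)) →
      μ (liminf (fun n => SingleOrbit.F T n (r n)) atTop) = 0) ∧
    -- the limsup set is null
    (∀ C s ε : ℝ, 0 < C → 0 < s → 0 < ε → SingleOrbit.ExpMixingBVL1 T μ →
      SingleOrbit.ShortReturnEstimate T μ C s →
      (∃ K : ℝ, ∀ᶠ n : ℕ in atTop,
        r n ≤ K * ((n : ℝ) ^ (-(1 / s)) * Real.log n ^ (-(2 / s) - ε))) →
      AntitoneOn (fun n : ℕ => (n : ℝ) * SingleOrbit.ballIntegral μ (r n)) (Ici 1) →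
      Summable (fun n : ℕ => (n : ℝ) * SingleOrbit.ballIntegral μ (r n)) →
      μ (limsup (fun n => SingleOrbit.F T n (r n)) atTop) = 0) ∧
    -- the liminf set has full measure
    (∀ β ε : ℝ, 0 < β → 0 < ε → SingleOrbit.Exp4Mixing T μ →
      AntitoneOn r (Ici 1) →
      (∀ᶠ n : ℕ in atTop, (n : ℝ) ^ (-β) ≤ r n) →
      (∀ᶠ n : ℕ in atTop,
        Real.log n ^ 4 * Real.log (Real.log n) ^ (2 + ε) / (n : ℝ) ^ 2
          ≤ SingleOrbit.ballIntegral μ (r n)) →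
      μ (liminf (fun n => SingleOrbit.F T n (4 * r n)) atTop) = 1) ∧
    -- the limsup set has full measure
    (∀ β : ℝ, 0 < β → SingleOrbit.Exp4Mixing T μ →
      (∀ᶠ n : ℕ in atTop, (n : ℝ) ^ (-β) ≤ r n) →
      ∀ h : ℕ → ℝ, Tendsto h atTop atTop →
      (∀ᶠ n : ℕ in atTop,
        Real.log n ^ 2 * h n / (n : ℝ) ^ 2 ≤ SingleOrbit.ballIntegral μ (r n)) →
      μ (limsup (fun n => SingleOrbit.F T n (4 * r n)) atTop) = 1) := by
  refine ⟨fun C s hC hs hmix hret h hh hrh hbh => ?_, fun C s ε hC hs hε hmix hret hK hanti hsum => ?_,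
    fun β ε _ hε hmix hanti _ hb => ?_, fun β _ hmix _ h hh hb => ?_⟩
  · exact SingleOrbit.measure_liminf_F_eq_zero hT hmix hC hs hret hr hh hrh hbh
  · obtain ⟨K, hK⟩ := hK
    exact SingleOrbit.measure_limsup_F_eq_zero hT hmix hC hs hε hret hr hK hanti hsum
  · exact SingleOrbit.measure_liminf_F_eq_one hT hmix hr hε hanti hb
  · exact SingleOrbit.measure_limsup_F_eq_one hT hmix hr hh hb
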